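/- \textbf{Setting.} The quality space is $\{L,H\}=\{0,1\}$, with uniform prior $\pi_0(0)=\pi_0(1)=\tfrac12$. Given $\eta\in(0,\tfrac12)$, the quality process is $Q_0=X_0$ and, for $t\ge 0$, $Q_{t+1}=X_{t+1}$ if $B_{t+1}=1$ and $Q_{t+1}=Q_t$ if $B_{t+1}=0$, where the $X_t$ are uniform on $\{0,1\}$ and the $B_t$ are Bernoulli with parameter $\eta$. Consumer $t\ge 1$ has a preference $\theta_t$ with law $\mu_\theta$ and a noise $\varepsilon_t$ with law $\mu_\varepsilon$. All the variables $\theta_t,\varepsilon_t,X_t,B_t$ are independent. Let $r(q,\theta)\in\mathbb R$ be a measurable reward function and $f(q,\theta,\varepsilon)\in\mathcal Z$ a measurable feedback function with values in a finite set $\mathcal Z$. For a belief $\pi$ (a probability distribution on $\{0,1\}$), a consumer with preference $\theta$ buys if and only if $\sum_q \pi(q)r(q,\theta)>0$. Her observable feedback under quality $q$ and noise $\varepsilon$ is $f(q,\theta,\varepsilon)$ if she buys and the symbol $*\notin\mathcal Z$ if she does not. For $z\in\mathcal Z\cup\{*\}$ let $G(z,\pi,q)$ be the probability, over independent $\theta\sim\mu_\theta$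 and $\varepsilon\sim\mu_\varepsilon$, that this feedback equals $z$, and let $G(z,\pi)=\sum_q\pi(q)G(z,\pi,q)$. \textbf{Assumptions.} (1) For every $\theta$, $r(q,\theta)$ is non-decreasing in $q$, and $\mathbb P(r(0,\theta_t)>0)\ge\delta$ for some $\delta>0$. (2) For every belief $\pi$ and all $q\neq q'$: $G(z,\pi,q)>0$ for every $z\in\mathcal Z$, and $G(z,\pi,q)\neq G(z,\pi,q')$ for some $z\in\mathcal Z$. \textbf{Imperfect learners.} They update their belief as if the quality were stationary: $\pi^{\mathrm{imp}}_1=\pi_0$ and, for $t\ge1$, $$\pi^{\mathrm{imp}}_{t+1}(q)=\frac{G(Z_t,\pi^{\mathrm{imp}}_t,q)}{G(Z_t,\pi^{\mathrm{imp}}_t)}\,\pi^{\mathrm{imp}}_t(q),$$ where $Z_t$ is the observable feedback of consumer $t$ under belief $\pi^{\mathrm{imp}}_t$, quality $Q_t$, preference $\theta_t$ and noise $\varepsilon_t$. Their loss is $\mathcal L^{\mathrm{imp}}_T=\sum_{t=1}^T\mathbb E[1-\pi^{\mathrm{imp}}_t(Q_t)]$. \textbf{Theorem.} If $\eta T=\Omega(1)$,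 then $\mathcal L^{\mathrm{imp}}_T=\Omega(T)$. That is: for given $r,f,\mu_\theta,\mu_\varepsilon$ satisfying (1) and (2) and every $c_0>0$, there is a constant $c>0$ such that for all integers $T\ge1$ and all $\eta\in(0,\tfrac12)$ with $\eta T\ge c_0$, $$\mathcal L^{\mathrm{imp}}_T\ \ge\ c\,T .$$ -/

import Mathlib

open MeasureTheory ProbabilityTheory

noncomputable section

namespace SocialLearning

/-- The quality space `{L, H} = {0, 1}`. Beliefs on it are the elements of
`stdSimplex ℝ Quality`. -/
abbrev Quality : Type := Fin 2

/-- The uniform prior. -/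
def prior : Quality → ℝ := fun _ => 1 / 2

section Market

variable {Θ E 𝓩 : Type*}

/-- Expected reward of purchasing, for a consumer with belief `π` and preference `θ`. -/
def expectedReward (r : Quality → Θ → ℝ) (π : Quality → ℝ) (θ : Θ) : ℝ :=
  ∑ q, π q * r q θ

/-- The observation left by a consumer with belief `π`, preference `θ` and noise `e` when the
quality is `q`: the review `f q θ e` if she buys (expected reward positive), and `none`
(written `∗` in the literature) if she does not buy. -/
def observation (r : Quality → Θ → ℝ) (f : Quality → Θ → E → 𝓩)
    (π : Quality → ℝ) (q : Quality) (θ : Θ) (e : E) : Option 𝓩 :=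
  if 0 < expectedReward r π θ then some (f q θ e) else none

variable [MeasurableSpace Θ] [MeasurableSpace E]

/-- `G z π q`: probability of the observation `z` under belief `π` and quality `q`, where the
preference has law `μΘ` and the noise, independent of it, has law `μE`. -/
def G (r : Quality → Θ → ℝ) (f : Quality → Θ → E → 𝓩) (μΘ : Measure Θ) (μE : Measure E)
    (z : Option 𝓩) (π : Quality → ℝ) (q : Quality) : ℝ :=
  (μΘ.prod μE).real {x | observation r f π q x.1 x.2 = z}

/-- `G z π`, the average of `G z π q` over `q` drawn from `π`. -/
def Gavg (r : Quality → Θ → ℝ) (f : Quality → Θ → E → 𝓩) (μΘ : Measure Θ) (μE : Measure E)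
    (z : Option 𝓩) (π : Quality → ℝ) : ℝ :=
  ∑ q, π q * G r f μΘ μE z π q

/-- Purchase guarantee: the reward is non-decreasing in the quality, and a positive fraction of
the consumers has a positive reward at the lowest quality. -/
def PurchaseGuarantee (r : Quality → Θ → ℝ) (μΘ : Measure Θ) : Prop :=
  (∀ θ, Monotone fun q => r q θ) ∧ ∃ δ > 0, δ ≤ μΘ.real {θ | 0 < r 0 θ}

/-- Identifiability: under every belief, each review has positive probability, and the review
distributions under the two qualities differ. -/
def Identifiable (r : Quality → Θ → ℝ) (f : Quality → Θ → E → 𝓩) (μΘ : Measure Θ)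
    (μE : Measure E) : Prop :=
  ∀ π ∈ stdSimplex ℝ Quality, ∀ q q' : Quality, q ≠ q' →
    (∀ z : 𝓩, 0 < G r f μΘ μE (some z) π q) ∧
      ∃ z : 𝓩, G r f μΘ μE (some z) π q ≠ G r f μΘ μE (some z) π q'

/-- Bayes' rule of the stationary model after the observation `z`. -/
def stationaryUpdate (r : Quality → Θ → ℝ) (f : Quality → Θ → E → 𝓩) (μΘ : Measure Θ)
    (μE : Measure E) (z : Option 𝓩) (π : Quality → ℝ) : Quality → ℝ :=
  fun q => G r f μΘ μE z π q / Gavg r f μΘ μE z π * π q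

end Market

section Dynamics

variable {Θ E 𝓩 Ω : Type*} [MeasurableSpace Θ] [MeasurableSpace E]

/-- The quality process: `Q 0 = X 0`, and `Q (t + 1)` is the fresh draw `X (t + 1)` if the
redraw coin `B (t + 1)` shows `true`, and `Q t` otherwise. -/
def quality (X : ℕ → Ω → Quality) (B : ℕ → Ω → Bool) : ℕ → Ω → Quality
  | 0, ω => X 0 ω
  | t + 1, ω => if B (t + 1) ω then X (t + 1) ω else quality X B t ω

/-- The belief `π t` of imperfect learners. The first consumer arrives at time `1`, so that
`π 1` is the prior (and `π 0` is set to the prior); `π (t + 1)` comes from `π t` by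
the stationary Bayes rule applied to the observation left by consumer `t`, whose purchase decision
is itself based on `π t`, while her review depends on the current quality. -/
def posteriorImp (r : Quality → Θ → ℝ) (f : Quality → Θ → E → 𝓩) (μΘ : Measure Θ)
    (μE : Measure E) (θ : ℕ → Ω → Θ) (ε : ℕ → Ω → E) (Q : ℕ → Ω → Quality) :
    ℕ → Ω → Quality → ℝ
  | 0, _ => prior
  | 1, _ => prior
  | t + 2, ω =>
    stationaryUpdate r f μΘ μE
      (observation r f (posteriorImp r f μΘ μE θ ε Q (t + 1) ω) (Q (t + 1) ω)
        (θ (t + 1) ω) (ε (t + 1) ω))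
      (posteriorImp r f μΘ μE θ ε Q (t + 1) ω)

variable [MeasurableSpace Ω]

/-- The random inputs of the dynamic model with redraw probability `η`: preferences `θ t` with law
`μΘ`, noises `ε t` with law `μE`, uniform fresh qualities `X t`, and coins `B t` that show `true`
with probability `η`; all these variables are independent, over all times and all four kinds. -/
structure IsDynamicModel (P : Measure Ω) (μΘ : Measure Θ) (μE : Measure E) (η : ℝ)
    (θ : ℕ → Ω → Θ) (ε : ℕ → Ω → E) (X : ℕ → Ω → Quality) (B : ℕ → Ω → Bool) : Prop where
  measurable_preference : ∀ t, Measurable (θ t)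
  measurable_noise : ∀ t, Measurable (ε t)
  measurable_draw : ∀ t, Measurable (X t)
  measurable_coin : ∀ t, Measurable (B t)
  law : ∀ t, P.map (fun ω => (θ t ω, ε t ω, X t ω, B t ω)) =
    μΘ.prod (μE.prod ((uniformOn (Set.univ : Set Quality)).prod
      (ENNReal.ofReal η • Measure.dirac true + ENNReal.ofReal (1 - η) • Measure.dirac false)))
  indep : iIndepFun (fun t ω => (θ t ω, ε t ω, X t ω, B t ω)) P

/-- The loss `∑ t = 1, …, T, 𝔼[1 - π t (Q t)]` of imperfect learners. -/
def lossImp (r : Quality → Θ → ℝ) (f : Quality → Θ → E → 𝓩) (μΘ : Measure Θ)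
    (μE : Measure E) (P : Measure Ω) (θ : ℕ → Ω → Θ) (ε : ℕ → Ω → E)
    (X : ℕ → Ω → Quality) (B : ℕ → Ω → Bool) (T : ℕ) : ℝ :=
  ∑ t ∈ Finset.Icc 1 T,
    ∫ ω, (1 - posteriorImp r f μΘ μE θ ε (quality X B) t ω (quality X B t ω)) ∂P

end Dynamics

end SocialLearning

end

/-! A redraw with probability `η` flips the quality with probability `ρ = η / 2`. The log-odds of
high quality held by stationary learners move by at most some `M` per period, because review
probabilities are bounded below uniformly over beliefs. Under high quality their drift is the
relative entropy between the two feedback laws: it is never negative, and it is at least some `k >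
0` above a level `L`, by identifiability and left-continuity of purchases at the belief 1.

So while the quality stays high, either the log-odds are often below `L`, where each period costs at
least `κ`, or they grow in proportion to the elapsed time. In the second case a flip to low quality
is expensive: log-odds `ℓ` need about `ℓ / M` periods to become negative, and each of these costs at
least `1 / 2`.

Take `N` of order `1 / η`, so that a flip within `N` periods has probability bounded below. Then `N`
periods that start with high quality cost a multiple of `N` (`value_one_ge`), and from low quality a
flip to high comes first (`value_zero_ge`). Every block of `2 * N` periods therefore costs a
multiple of `N`, uniformly in the initial belief, so blocks add up; `η * T ≥ c₀` makes at least one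
block fit. When `η` is not small, the uncertainty about the latest redraw is costly by itself
(`mul_le_redraw_value`).

`exists_isBeliefChain` provides the constants, and `IsDynamicModel.lossImp_eq` identifies the loss
with the value of the chain. -/

noncomputable section
namespace SocialLearning

/-! ### Loss of an abstract belief chain with a flipping quality -/

section Chain

variable {S ι : Type*} [Fintype ι]

/-- Expected loss accumulated over `n` periods by a controlled chain on `S` whose moves are drawn
with weights `K z s q`, while the quality flips with probability `ρ` after each period. -/
def value (K : ι → S → Quality → ℝ) (upd : ι → S → S) (loss : S → Quality → ℝ) (ρ : ℝ) :
    ℕ → S → Quality → ℝ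
  | 0, _, _ => 0
  | n + 1, s, q => loss s q + ∑ z, K z s q *
      ((1 - ρ) * value K upd loss ρ n (upd z s) q + ρ * value K upd loss ρ n (upd z s) (1 - q))

/-- A chain of beliefs with log-odds `ℓ`: the log-odds have increments bounded by `M`, do not
decrease on average under high quality, and have drift at least `k` above the level `L`, below
which the loss under high quality is at least `κ`. -/
structure IsBeliefChain (K : ι → S → Quality → ℝ) (upd : ι → S → S) (loss : S → Quality → ℝ)
    (good : S → Prop) (ℓ : S → ℝ) (M k κ L : ℝ) : Prop where
  nonneg : ∀ z s q, 0 ≤ K z s q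
  sum_eq_one : ∀ s q, ∑ z, K z s q = 1
  good_upd : ∀ z s q, good s → 0 < K z s q → good (upd z s)
  abs_sub_le : ∀ z s q, good s → 0 < K z s q → |ℓ (upd z s) - ℓ s| ≤ M
  le_drift : ∀ s, good s → ℓ s ≤ ∑ z, K z s 1 * ℓ (upd z s)
  add_le_drift : ∀ s, good s → L ≤ ℓ s → ℓ s + k ≤ ∑ z, K z s 1 * ℓ (upd z s)
  loss_nonneg : ∀ s q, good s → 0 ≤ loss s q
  loss_add_loss : ∀ s, good s → loss s 0 + loss s 1 = 1
  half_le_loss : ∀ s, good s → 0 ≤ ℓ s → 1 / 2 ≤ loss s 0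
  le_loss : ∀ s, good s → ℓ s < L → κ ≤ loss s 1
  pos_M : 0 < M
  pos_k : 0 < k
  pos_κ : 0 < κ
  nonneg_L : 0 ≤ L

namespace IsBeliefChain

variable {K : ι → S → Quality → ℝ} {upd : ι → S → S} {loss : S → Quality → ℝ}
  {good : S → Prop} {ℓ : S → ℝ} {M k κ L ρ : ℝ}

/-- Moves of weight zero may leave `good`, so only moves of positive weight are compared. -/
lemma sum_le_sum (hc : IsBeliefChain K upd loss good ℓ M k κ L) (s : S) (q : Quality)
    {g h : ι → ℝ} (hgh : ∀ z, 0 < K z s q → g z ≤ h z) :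
    ∑ z, K z s q * g z ≤ ∑ z, K z s q * h z := by
  refine Finset.sum_le_sum fun z _ => ?_
  rcases (hc.nonneg z s q).eq_or_lt with h0 | h0
  · simp [← h0]
  · exact mul_le_mul_of_nonneg_left (hgh z h0) h0.le

lemma le_sum (hc : IsBeliefChain K upd loss good ℓ M k κ L) (s : S) (q : Quality)
    {c : ℝ} {h : ι → ℝ} (hh : ∀ z, 0 < K z s q → c ≤ h z) :
    c ≤ ∑ z, K z s q * h z := by
  have := hc.sum_le_sum s q (g := fun _ => c) hh
  rwa [← Finset.sum_mul, hc.sum_eq_one, one_mul] at this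

lemma value_nonneg (hc : IsBeliefChain K upd loss good ℓ M k κ L) (h0 : 0 ≤ ρ) (h1 : ρ ≤ 1)
    (n : ℕ) (s : S) (hs : good s) (q : Quality) : 0 ≤ value K upd loss ρ n s q := by
  induction n generalizing s q with
  | zero => simp [value]
  | succ n ih =>
    rw [value]
    refine add_nonneg (hc.loss_nonneg s q hs) (hc.le_sum s q fun z hz => ?_)
    have hg := hc.good_upd z s q hs hz
    exact add_nonneg (mul_nonneg (by linarith) (ih _ hg _)) (mul_nonneg h0 (ih _ hg _))

/-- Markov property: after `m` periods the chain is in some good state, from which `n` more periods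
cost at least `C`. -/
lemma value_add_ge (hc : IsBeliefChain K upd loss good ℓ M k κ L) (h0 : 0 ≤ ρ) (h1 : ρ ≤ 1)
    {n : ℕ} {C : ℝ} (hn : ∀ s, good s → ∀ q, C ≤ value K upd loss ρ n s q)
    (m : ℕ) (s : S) (hs : good s) (q : Quality) :
    value K upd loss ρ m s q + C ≤ value K upd loss ρ (m + n) s q := by
  induction m generalizing s q with
  | zero => simpa [value] using hn s hs q
  | succ m ih =>
    rw [Nat.succ_add, value, value, add_assoc]
    refine add_le_add_right ?_ _
    have h := hc.sum_le_sum s q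
      (g := fun z => ((1 - ρ) * value K upd loss ρ m (upd z s) q +
        ρ * value K upd loss ρ m (upd z s) (1 - q)) + C)
      (h := fun z => ((1 - ρ) * value K upd loss ρ (m + n) (upd z s) q +
        ρ * value K upd loss ρ (m + n) (upd z s) (1 - q))) fun z hz => by
        have hg := hc.good_upd z s q hs hz
        nlinarith [mul_le_mul_of_nonneg_left (ih _ hg q) (sub_nonneg.2 h1),
          mul_le_mul_of_nonneg_left (ih _ hg (1 - q)) h0]
    simp only [mul_add _ _ C, Finset.sum_add_distrib] at h
    rwa [← Finset.sum_mul, hc.sum_eq_one, one_mul] at h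

lemma value_mono (hc : IsBeliefChain K upd loss good ℓ M k κ L) (h0 : 0 ≤ ρ) (h1 : ρ ≤ 1)
    (s : S) (hs : good s) (q : Quality) {m n : ℕ} (hmn : m ≤ n) :
    value K upd loss ρ m s q ≤ value K upd loss ρ n s q := by
  obtain ⟨d, rfl⟩ := Nat.exists_eq_add_of_le hmn
  simpa using hc.value_add_ge h0 h1 (fun s hs q => hc.value_nonneg h0 h1 d s hs q) m s hs q

/-- After the redraw both qualities have weight at least `ρ`, and their losses sum to one, so each
period costs at least `ρ`. -/
lemma mul_le_redraw_value (hc : IsBeliefChain K upd loss good ℓ M k κ L) (h0 : 0 ≤ ρ)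
    (h1 : ρ ≤ 1 / 2) (n : ℕ) (s : S) (hs : good s) (q : Quality) :
    ρ * n ≤ (1 - ρ) * value K upd loss ρ n s q + ρ * value K upd loss ρ n s (1 - q) := by
  induction n generalizing s q with
  | zero => simp [value]
  | succ n ih =>
    have key (q' : Quality) : loss s q' + ρ * n ≤ value K upd loss ρ (n + 1) s q' := by
      rw [value]
      exact add_le_add_right (hc.le_sum s q' fun z hz => ih _ (hc.good_upd z s q' hs hz) q') _
    have e : loss s q + loss s (1 - q) = 1 := by
      have := hc.loss_add_loss s hs
      fin_cases q
      · simpa using this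
      · simpa [add_comm] using this
    have a := key q
    have b := key (1 - q)
    have l := hc.loss_nonneg s q hs
    push_cast
    nlinarith [mul_le_mul_of_nonneg_left a (by linarith : 0 ≤ 1 - ρ),
      mul_le_mul_of_nonneg_left b h0, mul_nonneg (by linarith : 0 ≤ 1 - 2 * ρ) l]

/-- Bounded increments keep the log-odds non-negative for about `ℓ s / M` periods, each costing `1 /
2` under low quality. The power of `1 - ρ` pays for ignoring everything after a flip. -/
lemma min_le_value_zero (hc : IsBeliefChain K upd loss good ℓ M k κ L) (h0 : 0 ≤ ρ)
    (h1 : ρ ≤ 1) (n : ℕ) (s : S) (hs : good s) :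
    1 / 2 * (1 - ρ) ^ n * min (n : ℝ) (ℓ s / M) ≤ value K upd loss ρ n s 0 := by
  have hp (n : ℕ) : 0 ≤ (1 - ρ) ^ n := pow_nonneg (by linarith) n
  have hM := hc.pos_M
  induction n generalizing s with
  | zero =>
    have := min_le_left (0 : ℝ) (ℓ s / M)
    simp only [value, pow_zero, Nat.cast_zero]
    linarith
  | succ n ih =>
    rcases lt_or_ge (ℓ s) 0 with hl | hl
    · refine le_trans ?_ (hc.value_nonneg h0 h1 _ s hs 0)
      refine mul_nonpos_of_nonneg_of_nonpos (by linarith [hp (n + 1)]) ?_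
      exact (min_le_right _ _).trans (div_nonpos_of_nonpos_of_nonneg hl.le hM.le)
    · rw [value]
      have hx : 1 / 2 * (1 - ρ) ^ (n + 1) * min (n : ℝ) (ℓ s / M - 1) ≤ _ :=
        hc.le_sum s 0 (h := fun z => (1 - ρ) * value K upd loss ρ n (upd z s) 0 +
          ρ * value K upd loss ρ n (upd z s) (1 - 0)) fun z hz => by
        have hg := hc.good_upd z s 0 hs hz
        have hb := abs_le.1 (hc.abs_sub_le z s 0 hs hz)
        have hd : ℓ s / M - 1 ≤ ℓ (upd z s) / M := by
          rw [sub_le_iff_le_add, div_add_one hM.ne']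
          gcongr
          linarith
        have h2 : 1 / 2 * (1 - ρ) ^ n * min (n : ℝ) (ℓ s / M - 1) ≤
            value K upd loss ρ n (upd z s) 0 :=
          le_trans (mul_le_mul_of_nonneg_left (min_le_min_left _ hd)
            (by linarith [hp n])) (ih _ hg)
        have h3 := mul_nonneg h0 (hc.value_nonneg h0 h1 n _ hg (1 - 0))
        calc _ = (1 - ρ) * (1 / 2 * (1 - ρ) ^ n * min (n : ℝ) (ℓ s / M - 1)) := by ring
          _ ≤ (1 - ρ) * value K upd loss ρ n (upd z s) 0 :=
            mul_le_mul_of_nonneg_left h2 (by linarith)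
          _ ≤ _ := by linarith
      have hm : min ((n + 1 : ℕ) : ℝ) (ℓ s / M) = min (n : ℝ) (ℓ s / M - 1) + 1 := by
        rw [← min_add_add_right]; simp
      have hq : (1 - ρ) ^ (n + 1) ≤ 1 := pow_le_one₀ (by linarith) (by linarith)
      rw [hm]
      linarith [hc.half_le_loss s hs hl]

/-- The log-odds cannot become negative within `n` periods, so a flip with `j` periods left costs `j
/ 2`, up to powers of `1 - ρ`. Summing `ρ * j / 2` over `j < n` gives the bound. -/
lemma value_one_ge_of_mul_le (hc : IsBeliefChain K upd loss good ℓ M k κ L) (h0 : 0 ≤ ρ)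
    (h1 : ρ ≤ 1) (n : ℕ) (s : S) (hs : good s) (hl : M * n ≤ ℓ s) :
    (1 - ρ) ^ n * (ρ * (n * (n - 1) / 4)) ≤ value K upd loss ρ n s 1 := by
  have hp (n : ℕ) : 0 ≤ (1 - ρ) ^ n := pow_nonneg (by linarith) n
  have hM := hc.pos_M
  induction n generalizing s with
  | zero => simp [value]
  | succ n ih =>
    rw [value]
    have hx := hc.le_sum s 1 (c := (1 - ρ) ^ (n + 1) * (ρ * ((n + 1 : ℕ) * ((n + 1 : ℕ) - 1) / 4)))
      (h := fun z => (1 - ρ) * value K upd loss ρ n (upd z s) 1 +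
          ρ * value K upd loss ρ n (upd z s) (1 - 1)) fun z hz => by
      have hg := hc.good_upd z s 1 hs hz
      have hb := abs_le.1 (hc.abs_sub_le z s 1 hs hz)
      push_cast at hl
      have hl' : M * n ≤ ℓ (upd z s) := by linarith
      have i1 := mul_le_mul_of_nonneg_left (ih _ hg hl') (by linarith : 0 ≤ 1 - ρ)
      have i2 := hc.min_le_value_zero h0 h1 n _ hg
      rw [min_eq_left (by rwa [le_div_iff₀ hM, mul_comm])] at i2
      have i3 := mul_le_mul_of_nonneg_left i2 h0
      have i4 : (1 - ρ) ^ (n + 1) * (ρ * n / 2) ≤ (1 - ρ) ^ n * (ρ * n / 2) := by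
        refine mul_le_mul_of_nonneg_right ?_ (by positivity)
        exact pow_le_pow_of_le_one (by linarith) (by linarith) n.le_succ
      rw [sub_self]
      push_cast
      calc (1 - ρ) ^ (n + 1) * (ρ * ((n + 1 : ℝ) * (n + 1 - 1) / 4))
          = (1 - ρ) * ((1 - ρ) ^ n * (ρ * (n * (n - 1) / 4))) +
            (1 - ρ) ^ (n + 1) * (ρ * n / 2) := by ring
        _ ≤ _ := by linarith
    linarith [hc.loss_nonneg s 1 hs]

lemma max_drift (hc : IsBeliefChain K upd loss good ℓ M k κ L) (s : S) (hs : good s) :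
    max (ℓ s) 0 ≤ ∑ z, K z s 1 * max (ℓ (upd z s)) 0 := by
  refine max_le ((hc.le_drift s hs).trans ?_) (hc.le_sum s 1 fun z _ => le_max_right _ _)
  exact hc.sum_le_sum s 1 fun z _ => le_max_left _ _

lemma max_add_drift (hc : IsBeliefChain K upd loss good ℓ M k κ L) (s : S) (hs : good s)
    (hl : L ≤ ℓ s) : max (ℓ s) 0 + k ≤ ∑ z, K z s 1 * max (ℓ (upd z s)) 0 := by
  rw [max_eq_left (hc.nonneg_L.trans hl)]
  exact (hc.add_le_drift s hs hl).trans (hc.sum_le_sum s 1 fun z _ => le_max_left _ _)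

/-- Under high quality, either the log-odds are often below `L`, which is costly at once, or they
grow, which is costly after the next flip. -/
lemma value_one_ge_of_le (hc : IsBeliefChain K upd loss good ℓ M k κ L) (h0 : 0 ≤ ρ)
    {N : ℕ} (hN : 0 < N) (hρN : ρ * (2 * N) ≤ 1 / 2) (hk : k ≤ 64 * M * κ)
    (n : ℕ) (hn : n ≤ N) (s : S) (hs : good s) (hl : max (ℓ s) 0 ≤ M * (2 * N - n)) :
    (1 - ρ) ^ n * (ρ / (8 * N * M) * (n * (n - 1) / 2 * max (ℓ s) 0 +
      k * (n * (n - 1) * (n - 2) / 6))) ≤ value K upd loss ρ n s 1 := by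
  have hM := hc.pos_M
  have hk0 := hc.pos_k
  have hNr : (1 : ℝ) ≤ N := by exact_mod_cast hN
  have h1 : ρ ≤ 1 := by nlinarith
  have hp (n : ℕ) : 0 ≤ (1 - ρ) ^ n := pow_nonneg (by linarith) n
  -- Up to `(1 - ρ) ^ n`, a flip to low quality will be worth `2 * e * n * ψ`; half of that
  -- suffices.
  set e := ρ / (8 * N * M) with he
  have he0 : 0 ≤ e := by positivity
  induction n generalizing s with
  | zero => simp [value]
  | succ n ih =>
    have hnN : (n : ℝ) + 1 ≤ N := by exact_mod_cast hn
    have hn0 : (0 : ℝ) ≤ n := n.cast_nonneg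
    have hn1 : (0 : ℝ) ≤ n * (n - 1) := by
      rcases n with _ | n
      · simp
      · push_cast; rw [add_sub_cancel_right]; positivity
    push_cast at hl ⊢
    -- The bound is affine in the positive part of the log-odds, with slope `A` and constant `B`.
    -- One more period adds `e * n` to the slope (a flip) and `A * k` to the constant (the drift).
    set A := e * (n * (n - 1) / 2) with hA
    set B := e * (k * (n * (n - 1) * (n - 2) / 6)) with hB
    have hA0 : 0 ≤ A := mul_nonneg he0 (by linarith)
    have hstep : ∀ z, 0 < K z s 1 →
        (1 - ρ) ^ (n + 1) * ((A + e * n) * max (ℓ (upd z s)) 0 + B) ≤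
        (1 - ρ) * value K upd loss ρ n (upd z s) 1 +
          ρ * value K upd loss ρ n (upd z s) (1 - 1) := fun z hz => by
      have hg := hc.good_upd z s 1 hs hz
      have hb := abs_le.1 (hc.abs_sub_le z s 1 hs hz)
      set ψ := max (ℓ (upd z s)) 0 with hψ
      have hψ0 : 0 ≤ ψ := le_max_right _ _
      -- The admissible level rises by `M` as `n` drops by one, which absorbs the increment.
      have hψl : ψ ≤ M * (2 * N - n) := by
        refine max_le ?_ (mul_nonneg hM.le (by linarith))
        linarith [le_max_left (ℓ s) 0]
      have i1 := mul_le_mul_of_nonneg_left (ih (by lia) _ hg hψl) (by linarith : 0 ≤ 1 - ρ)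
      have i2 : 1 / 2 * (1 - ρ) ^ n * (n * (ψ / M) / (2 * N)) ≤
          value K upd loss ρ n (upd z s) 0 := by
        rcases le_total (ℓ (upd z s)) 0 with h | h
        · rw [hψ, max_eq_right h]
          simpa using hc.value_nonneg h0 h1 n _ hg 0
        -- Both `n` and `ψ / M` are at most `2 * N`, so their minimum dominates their product over
        -- `2 * N`, which is linear in `ψ` and can be averaged.
        · refine le_trans (mul_le_mul_of_nonneg_left ?_ (by linarith [hp n]))
            (hc.min_le_value_zero h0 h1 n _ hg)
          rw [hψ, max_eq_left h] at *
          have hx0 : 0 ≤ ℓ (upd z s) / M := by positivity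
          have hx : ℓ (upd z s) / M ≤ 2 * N := by
            rw [div_le_iff₀ hM]; nlinarith
          refine le_min ?_ ?_ <;> rw [div_le_iff₀ (by linarith)]
          · exact mul_le_mul_of_nonneg_left hx hn0
          · rw [mul_comm]; exact mul_le_mul_of_nonneg_left (by linarith) hx0
      have i3 := mul_le_mul_of_nonneg_left i2 h0
      have i4 : (1 - ρ) ^ (n + 1) * (e * n * ψ) ≤
          ρ * (1 / 2 * (1 - ρ) ^ n * (n * (ψ / M) / (2 * N))) := by
        have : ρ * (1 / 2 * (1 - ρ) ^ n * (n * (ψ / M) / (2 * N))) =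
            (1 - ρ) ^ n * (2 * (e * n * ψ)) := by
          rw [he]; field_simp; ring
        rw [this]
        have h5 : 0 ≤ e * n * ψ := by positivity
        refine mul_le_mul ?_ (by linarith) h5 (hp n)
        exact pow_le_pow_of_le_one (by linarith) (by linarith) n.le_succ
      rw [sub_self]
      calc _ = (1 - ρ) * ((1 - ρ) ^ n * (e * (n * (n - 1) / 2 * ψ +
            k * (n * (n - 1) * (n - 2) / 6)))) + (1 - ρ) ^ (n + 1) * (e * n * ψ) := by
            rw [hA, hB]; ring
        _ ≤ _ := by linarith
    have hsum := hc.sum_le_sum s 1 hstep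
    have hlin : ∑ z, K z s 1 * ((1 - ρ) ^ (n + 1) * ((A + e * n) * max (ℓ (upd z s)) 0 + B)) =
        (1 - ρ) ^ (n + 1) * ((A + e * n) * (∑ z, K z s 1 * max (ℓ (upd z s)) 0) + B) := by
      calc _ = ∑ z, ((1 - ρ) ^ (n + 1) * (A + e * n) * (K z s 1 * max (ℓ (upd z s)) 0) +
            (1 - ρ) ^ (n + 1) * B * K z s 1) := Finset.sum_congr rfl fun z _ => by ring
        _ = _ := by
          rw [Finset.sum_add_distrib, ← Finset.mul_sum, ← Finset.mul_sum, hc.sum_eq_one]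
          ring
    rw [hlin] at hsum
    have hpl : (1 - ρ) ^ (n + 1) ≤ 1 := pow_le_one₀ (by linarith) (by linarith)
    -- Below `L` the immediate loss `κ` must replace the missing drift gain `A * k`. From `n ≤ N`
    -- and `ρ * N ≤ 1 / 4` follows `A ≤ 1 / (64 * M)`, the origin of the constant 64.
    have hAk : A * k ≤ κ := by
      have h8 : A ≤ 1 / (64 * M) := by
        rw [hA, he, div_mul_eq_mul_div, div_le_div_iff₀ (by positivity) (by positivity)]
        have : (n : ℝ) * (n - 1) ≤ N * N := by nlinarith
        have h9 : ρ * (n * (n - 1)) ≤ ρ * (N * N) := mul_le_mul_of_nonneg_left this h0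
        nlinarith [mul_le_mul_of_nonneg_right hρN (by positivity : (0:ℝ) ≤ N * M),
          mul_le_mul_of_nonneg_right h9 hM.le]
      calc A * k ≤ 1 / (64 * M) * (64 * M * κ) := mul_le_mul h8 hk hk0.le (by positivity)
        _ = κ := by field_simp
    have hgain : (1 - ρ) ^ (n + 1) * ((A + e * n) * max (ℓ s) 0 + B + A * k) ≤
        loss s 1 + (1 - ρ) ^ (n + 1) *
          ((A + e * n) * (∑ z, K z s 1 * max (ℓ (upd z s)) 0) + B) := by
      have hAe : 0 ≤ A + e * n := by positivity
      rcases lt_or_ge (ℓ s) L with h | h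
      · have j1 := hc.le_loss s hs h
        have j2 := mul_le_mul_of_nonneg_left
          (mul_le_mul_of_nonneg_left (hc.max_drift s hs) hAe) (hp (n + 1))
        have j3 : (1 - ρ) ^ (n + 1) * (A * k) ≤ 1 * (A * k) :=
          mul_le_mul_of_nonneg_right hpl (by positivity)
        linarith
      · have j1 := hc.loss_nonneg s 1 hs
        have j2 := mul_le_mul_of_nonneg_left
          (mul_le_mul_of_nonneg_left (hc.max_add_drift s hs h) hAe) (hp (n + 1))
        have j3 : 0 ≤ (1 - ρ) ^ (n + 1) * (e * n * k) :=
          mul_nonneg (hp _) (by positivity)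
        linarith
    rw [value]
    calc _ = (1 - ρ) ^ (n + 1) * ((A + e * n) * max (ℓ s) 0 + B + A * k) := by
          rw [hA, hB]; ring
      _ ≤ _ := hgain.trans (by linarith)

lemma half_le_one_sub_pow {N : ℕ} (h0 : 0 ≤ ρ) (h1 : ρ ≤ 1) (hρN : ρ * (2 * N) ≤ 1 / 2) {n : ℕ}
    (hn : n ≤ N) : 1 / 2 ≤ (1 - ρ) ^ n := by
  have h := one_add_mul_le_pow (by linarith : -2 ≤ -ρ) n
  have : (n : ℝ) ≤ N := by exact_mod_cast hn
  rw [← sub_eq_add_neg] at h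
  linarith [mul_le_mul_of_nonneg_left this h0]

/-- Log-odds above `M * N` stay non-negative throughout; below that, the growth estimate applies
with `n = N`, and its cubic term alone suffices. There `384 = 2 * 8 * 24`, with 2 from `(1 - ρ) ^ N
≥ 1 / 2` and 24 from the cubic. -/
lemma value_one_ge (hc : IsBeliefChain K upd loss good ℓ M k κ L) (h0 : 0 ≤ ρ)
    {N : ℕ} (hN : 4 ≤ N) (hρN : ρ * (2 * N) ≤ 1 / 2) (hk : k ≤ 64 * M * κ) {a : ℝ}
    (ha : a ≤ ρ * N) (ha0 : 0 < a) (s : S) (hs : good s) :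
    a * min (k / (384 * M)) (1 / 16) * N ≤ value K upd loss ρ N s 1 := by
  have hM := hc.pos_M
  have hk0 := hc.pos_k
  have hNr : (4 : ℝ) ≤ N := by exact_mod_cast hN
  have h1 : ρ ≤ 1 := by nlinarith
  have hh := half_le_one_sub_pow h0 h1 hρN le_rfl
  rcases le_total (M * N) (ℓ s) with h | h
  · refine le_trans ?_ (hc.value_one_ge_of_mul_le h0 h1 N s hs h)
    calc a * min (k / (384 * M)) (1 / 16) * N ≤ a * (1 / 16) * N := by
          gcongr; exact min_le_right _ _
      _ ≤ ρ * N * (1 / 16) * N := by gcongr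
      _ ≤ 1 / 2 * (ρ * (N * (N - 1) / 4)) := by
          have : 0 ≤ ρ * N * (N - 2) := mul_nonneg (by positivity) (by linarith)
          linarith
      _ ≤ _ := mul_le_mul_of_nonneg_right hh (mul_nonneg h0 (by
          have : 0 ≤ (N : ℝ) * (N - 1) := mul_nonneg (by positivity) (by linarith)
          linarith))
  · have hl : max (ℓ s) 0 ≤ M * (2 * N - N) :=
      max_le (by linarith) (mul_nonneg hM.le (by linarith))
    refine le_trans ?_ (hc.value_one_ge_of_le h0 (by lia) hρN hk N le_rfl s hs hl)
    have hN1 : 0 ≤ (N : ℝ) * (N - 1) := mul_nonneg (by positivity) (by linarith)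
    have hN2 : 0 ≤ (N : ℝ) * (N - 1) * (N - 2) := mul_nonneg hN1 (by linarith)
    have hcub : (N : ℝ) ^ 3 / 24 ≤ N * (N - 1) * (N - 2) / 6 := by
      have : 0 ≤ (N : ℝ) * (3 * N * (N - 4) + 8) :=
        mul_nonneg (by positivity) (add_nonneg (mul_nonneg (by positivity) (by linarith)) (by norm_num))
      nlinarith
    calc a * min (k / (384 * M)) (1 / 16) * N ≤ a * (k / (384 * M)) * N := by
          gcongr; exact min_le_left _ _
      _ ≤ ρ * N * (k / (384 * M)) * N := by gcongr
      _ = 1 / 2 * (ρ / (8 * N * M) * (0 + k * (N ^ 3 / 24))) := by field_simp; ring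
      _ ≤ _ := by
        gcongr
        exact mul_nonneg (by linarith) (le_max_right _ _)

/-- A flip to high quality after one of the first `j` periods leaves at least `N` periods, worth
`C`. -/
lemma value_zero_ge (hc : IsBeliefChain K upd loss good ℓ M k κ L) (h0 : 0 ≤ ρ)
    (h1 : ρ ≤ 1) {N : ℕ} {C : ℝ} (hC : 0 ≤ C)
    (hN : ∀ s, good s → C ≤ value K upd loss ρ N s 1) (j : ℕ) (s : S) (hs : good s) :
    (1 - ρ) ^ j * (ρ * j * C) ≤ value K upd loss ρ (j + N) s 0 := by
  induction j generalizing s with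
  | zero => simpa using hc.value_nonneg h0 h1 N s hs 0
  | succ j ih =>
    rw [Nat.succ_add, value]
    have hx := hc.le_sum s 0 (c := (1 - ρ) ^ (j + 1) * (ρ * (j + 1 : ℕ) * C))
      (h := fun z => (1 - ρ) * value K upd loss ρ (j + N) (upd z s) 0 +
          ρ * value K upd loss ρ (j + N) (upd z s) (1 - 0)) fun z hz => by
      have hg := hc.good_upd z s 0 hs hz
      have i1 := mul_le_mul_of_nonneg_left (ih _ hg) (by linarith : 0 ≤ 1 - ρ)
      have i2 := mul_le_mul_of_nonneg_left
        ((hN _ hg).trans (hc.value_mono h0 h1 _ hg 1 (Nat.le_add_left N j))) h0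
      have i3 : (1 - ρ) ^ (j + 1) * (ρ * C) ≤ 1 * (ρ * C) :=
        mul_le_mul_of_nonneg_right (pow_le_one₀ (by linarith) (by linarith)) (by positivity)
      rw [sub_zero]
      push_cast
      calc _ = (1 - ρ) * ((1 - ρ) ^ j * (ρ * j * C)) + (1 - ρ) ^ (j + 1) * (ρ * C) := by ring
        _ ≤ _ := by linarith
    linarith [hc.loss_nonneg s 0 hs]

lemma value_mul_ge (hc : IsBeliefChain K upd loss good ℓ M k κ L) (h0 : 0 ≤ ρ)
    (h1 : ρ ≤ 1) {N : ℕ} {C : ℝ} (hN : ∀ s, good s → ∀ q, C ≤ value K upd loss ρ N s q)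
    (m : ℕ) (s : S) (hs : good s) (q : Quality) :
    m * C ≤ value K upd loss ρ (m * N) s q := by
  induction m generalizing s q with
  | zero => simp [value]
  | succ m ih =>
    have := hc.value_add_ge h0 h1 hN (m * N) s hs q
    rw [Nat.succ_mul]
    push_cast
    linarith [ih s hs q]

lemma exists_mul_le_redraw_value (hc : IsBeliefChain K upd loss good ℓ M k κ L)
    (hk : k ≤ 64 * M * κ) {c₀ : ℝ} (hc₀ : 0 < c₀) :
    ∃ c : ℝ, 0 < c ∧ ∀ (T : ℕ) (η : ℝ), 1 ≤ T → 0 < η → η < 1 / 2 → c₀ ≤ η * T →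
      ∀ s, good s → ∀ q, c * T ≤ (1 - η / 2) * value K upd loss (η / 2) T s q +
        η / 2 * value K upd loss (η / 2) T s (1 - q) := by
  have hM := hc.pos_M
  have hk0 := hc.pos_k
  -- With `N` close to `a / η`, the bound `1 / 4` keeps flips rare within a block, and `c₀ / 4`
  -- makes `2 * N` at most `T`.
  set a : ℝ := min (1 / 4) (c₀ / 4) with ha
  have ha0 : 0 < a := lt_min (by norm_num) (by positivity)
  have ha1 : a ≤ 1 / 4 := min_le_left _ _
  have hac : a ≤ c₀ / 4 := min_le_right _ _
  set d : ℝ := a / 4 * min (k / (384 * M)) (1 / 16) with hd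
  have hd0 : 0 < d := mul_pos (by positivity) (lt_min (by positivity) (by norm_num))
  refine ⟨min (a / 8) (a / 8 * d / 4), lt_min (by positivity) (by positivity), ?_⟩
  intro T η hT hη0 hη1 hηT s hs q
  have hT0 : (1 : ℝ) ≤ T := by exact_mod_cast hT
  -- For `η` above `a / 4` the redraw alone costs `η / 2` per period; otherwise `a / η ≥ 4`, so that
  -- `N ≥ 4`.
  rcases le_total (a / 4) η with hη | hη
  · refine le_trans ?_ (hc.mul_le_redraw_value (by linarith) (by linarith) T s hs q)
    gcongr
    exact (min_le_left _ _).trans (by linarith)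
  set N : ℕ := ⌊a / η⌋₊ with hNdef
  have hN4 : 4 ≤ N := Nat.le_floor (by
    rw [le_div_iff₀ hη0]; push_cast; linarith)
  have hNr : (4 : ℝ) ≤ N := by exact_mod_cast hN4
  have hNle : (N : ℝ) * η ≤ a := by
    rw [← le_div_iff₀ hη0]; exact Nat.floor_le (by positivity)
  have hNge : a ≤ (N + 1) * η := by
    rw [← div_le_iff₀ hη0]; exact (Nat.lt_floor_add_one _).le
  have hρ0 : 0 ≤ η / 2 := by linarith
  have hρ1 : η / 2 ≤ 1 := by linarith
  have hρN : η / 2 * (2 * N) ≤ 1 / 2 := by linarith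
  have haN : a / 4 ≤ η / 2 * N := by nlinarith
  have hone := fun s hs => hc.value_one_ge hρ0 hN4 hρN hk haN (by positivity) s hs
  rw [← hd] at hone
  have hblock : ∀ s, good s → ∀ q, a / 8 * d * N ≤ value K upd loss (η / 2) (N + N) s q := by
    intro s hs q
    fin_cases q
    · refine le_trans ?_ (hc.value_zero_ge hρ0 hρ1 (by positivity) hone N s hs)
      calc a / 8 * d * N = 1 / 2 * (a / 4 * (d * N)) := by ring
        _ ≤ _ := by
          have := half_le_one_sub_pow hρ0 hρ1 hρN le_rfl
          gcongr
    · refine le_trans ?_ ((hone s hs).trans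
        (hc.value_mono hρ0 hρ1 s hs 1 (Nat.le_add_left N N)))
      gcongr
      nlinarith
  set m := T / (N + N) with hm
  have hTN : (N : ℝ) + N ≤ T := by
    have : η * (N + N) ≤ η * T := by nlinarith
    exact le_of_mul_le_mul_left this hη0
  have hTN' : N + N ≤ T := by exact_mod_cast hTN
  have hm1 : 1 ≤ m := (Nat.one_le_div_iff (by lia)).2 hTN'
  have hTm : (T : ℝ) ≤ 4 * N * m := by
    have h2 : T < (N + N) * (m + 1) := Nat.lt_mul_div_succ T (by lia)
    have h3 : T ≤ 4 * N * m := by nlinarith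
    exact_mod_cast h3
  have hall : ∀ q, min (a / 8) (a / 8 * d / 4) * T ≤ value K upd loss (η / 2) T s q := fun q => by
    refine le_trans ?_ ((hc.value_mul_ge hρ0 hρ1 hblock m s hs q).trans
      (hc.value_mono hρ0 hρ1 s hs q (Nat.div_mul_le_self T (N + N))))
    calc _ ≤ a / 8 * d / 4 * (4 * N * m) := by
          gcongr; exact min_le_right _ _
      _ = _ := by ring
  nlinarith [mul_le_mul_of_nonneg_left (hall q) (by linarith : 0 ≤ 1 - η / 2),
    mul_le_mul_of_nonneg_left (hall (1 - q)) hρ0]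

end IsBeliefChain
end Chain
end SocialLearning
end
-- Beliefs, log-odds and their drift
noncomputable section
namespace SocialLearning

open Filter Topology

/-- The probability of each quality is positive and they sum to one. -/
def IsInteriorBelief (π : Quality → ℝ) : Prop := 0 < π 0 ∧ 0 < π 1 ∧ π 0 + π 1 = 1

/-- The log-odds of high quality. -/
def logOdds (π : Quality → ℝ) : ℝ := Real.log (π 1 / π 0)

/-- The belief that the quality is high with probability `x`. -/
def beliefOf (x : ℝ) : Quality → ℝ := ![1 - x, x]

lemma beliefOf_mem_stdSimplex {x : ℝ} (h0 : 0 ≤ x) (h1 : x ≤ 1) :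
    beliefOf x ∈ stdSimplex ℝ Quality :=
  ⟨fun q => by fin_cases q <;> simp [beliefOf, h0, h1], by simp [beliefOf]⟩

lemma IsInteriorBelief.eq_beliefOf {π : Quality → ℝ} (h : IsInteriorBelief π) :
    π = beliefOf (π 1) := by
  have := h.2.2
  ext q
  fin_cases q
  · simp [beliefOf]; linarith
  · simp [beliefOf]

lemma IsInteriorBelief.mem_stdSimplex {π : Quality → ℝ} (h : IsInteriorBelief π) :
    π ∈ stdSimplex ℝ Quality := by
  rw [h.eq_beliefOf]
  exact beliefOf_mem_stdSimplex h.2.1.le (by linarith [h.1, h.2.2])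

section Divergence

variable {ι : Type*}

lemma sub_le_mul_log_div {p q : ℝ} (hp : 0 < p) (hq : 0 < q) : p - q ≤ p * Real.log (p / q) := by
  have h := Real.one_sub_inv_le_log_of_pos (div_pos hp hq)
  calc p - q = p * (1 - (p / q)⁻¹) := by field_simp
    _ ≤ _ := mul_le_mul_of_nonneg_left h hp.le

lemma sub_lt_mul_log_div {p q : ℝ} (hp : 0 < p) (hq : 0 < q) (hpq : p ≠ q) :
    p - q < p * Real.log (p / q) := by
  have h := Real.log_lt_sub_one_of_pos (div_pos hq hp) fun h => hpq ((div_eq_one_iff_eq hp.ne').1 h).symm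
  rw [← inv_div q p, Real.log_inv]
  calc p - q = p * -(q / p - 1) := by field_simp; ring
    _ < _ := mul_lt_mul_of_pos_left (by linarith) hp

/-- Gibbs' inequality. The alternative `p z = q z` admits atoms that vanish under both laws, as
`none` may. -/
lemma sum_mul_log_div_nonneg [Fintype ι] {p q : ι → ℝ}
    (hpq : ∀ z, p z = q z ∨ (0 < p z ∧ 0 < q z)) (hs : ∑ z, p z = ∑ z, q z) :
    0 ≤ ∑ z, p z * Real.log (p z / q z) := by
  have : ∑ z, (p z - q z) ≤ ∑ z, p z * Real.log (p z / q z) :=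
    Finset.sum_le_sum fun z _ => by
      rcases hpq z with h | h
      · rcases eq_or_ne (q z) 0 with h0 | h0 <;> simp [h, h0]
      · exact sub_le_mul_log_div h.1 h.2
  simpa [hs] using this

lemma sum_mul_log_div_pos [Fintype ι] {p q : ι → ℝ}
    (hpq : ∀ z, p z = q z ∨ (0 < p z ∧ 0 < q z)) (hs : ∑ z, p z = ∑ z, q z)
    (hne : ∃ z, p z ≠ q z) :
    0 < ∑ z, p z * Real.log (p z / q z) := by
  have : ∑ z, (p z - q z) < ∑ z, p z * Real.log (p z / q z) := by
    obtain ⟨z₀, hz₀⟩ := hne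
    refine Finset.sum_lt_sum (fun z _ => ?_) ⟨z₀, Finset.mem_univ _, ?_⟩
    · rcases hpq z with h | h
      · rcases eq_or_ne (q z) 0 with h0 | h0 <;> simp [h, h0]
      · exact sub_le_mul_log_div h.1 h.2
    · obtain ⟨h1, h2⟩ := (hpq z₀).resolve_left hz₀
      exact sub_lt_mul_log_div h1 h2 hz₀
  simpa [hs] using this

end Divergence

section Feedback

variable {Θ E 𝓩 : Type*} {r : Quality → Θ → ℝ} {f : Quality → Θ → E → 𝓩}

lemma observation_eq_some_iff {π : Quality → ℝ} {q : Quality} {θ : Θ} {e : E} {z : 𝓩} :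
    observation r f π q θ e = some z ↔ 0 < expectedReward r π θ ∧ f q θ e = z := by
  unfold observation
  split_ifs with h <;> simp [h]

lemma observation_eq_none_iff {π : Quality → ℝ} {q : Quality} {θ : Θ} {e : E} :
    observation r f π q θ e = none ↔ ¬ 0 < expectedReward r π θ := by
  unfold observation
  split_ifs with h <;> simp [h]

variable [MeasurableSpace Θ] [MeasurableSpace E] {μΘ : Measure Θ} {μE : Measure E}

lemma measurable_expectedReward (hr : ∀ q, Measurable (r q)) (π : Quality → ℝ) :
    Measurable (expectedReward r π) := by
  unfold expectedReward
  exact Finset.measurable_sum _ fun q _ => (hr q).const_mul (π q)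

lemma measurableSet_observation_eq [MeasurableSpace 𝓩] [MeasurableSingletonClass 𝓩]
    (hr : ∀ q, Measurable (r q)) (hf : ∀ q, Measurable fun x : Θ × E => f q x.1 x.2)
    (π : Quality → ℝ) (q : Quality) (z : Option 𝓩) :
    MeasurableSet {x : Θ × E | observation r f π q x.1 x.2 = z} := by
  have hb : MeasurableSet {x : Θ × E | 0 < expectedReward r π x.1} :=
    measurableSet_lt measurable_const ((measurable_expectedReward hr π).comp measurable_fst)
  cases z with
  | none =>
    simp only [observation_eq_none_iff]
    exact hb.compl
  | some z =>
    simp only [observation_eq_some_iff]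
    exact hb.inter (hf q (measurableSet_singleton z))

lemma G_nonneg (z : Option 𝓩) (π : Quality → ℝ) (q : Quality) : 0 ≤ G r f μΘ μE z π q :=
  measureReal_nonneg

/-- The purchase depends on belief and preference only, so its absence says nothing about the
quality. -/
lemma G_none_eq (π : Quality → ℝ) (q q' : Quality) :
    G r f μΘ μE none π q = G r f μΘ μE none π q' := by
  simp only [G, observation_eq_none_iff]

lemma G_le_one [IsProbabilityMeasure μΘ] [IsProbabilityMeasure μE] (z : Option 𝓩)
    (π : Quality → ℝ) (q : Quality) : G r f μΘ μE z π q ≤ 1 :=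
  measureReal_le_one

lemma sum_G [Fintype 𝓩] [MeasurableSpace 𝓩] [MeasurableSingletonClass 𝓩]
    [IsProbabilityMeasure μΘ] [IsProbabilityMeasure μE]
    (hr : ∀ q, Measurable (r q)) (hf : ∀ q, Measurable fun x : Θ × E => f q x.1 x.2)
    (π : Quality → ℝ) (q : Quality) : ∑ z, G r f μΘ μE z π q = 1 := by
  have := sum_measureReal_preimage_singleton (μ := μΘ.prod μE) Finset.univ
    (f := fun x : Θ × E => observation r f π q x.1 x.2)
    fun z _ => measurableSet_observation_eq hr hf π q z
  rwa [Finset.coe_univ, Set.preimage_univ, probReal_univ] at this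

/-- Those who buy under the worst belief buy under every belief. -/
lemma G_some_beliefOf_zero_le [IsProbabilityMeasure μΘ] [IsProbabilityMeasure μE]
    (hmono : ∀ θ, Monotone fun q => r q θ) {π : Quality → ℝ} (hπ : IsInteriorBelief π)
    (z : 𝓩) (q : Quality) :
    G r f μΘ μE (some z) (beliefOf 0) q ≤ G r f μΘ μE (some z) π q := by
  refine measureReal_mono fun x hx => ?_
  simp only [Set.mem_ofPred_eq, observation_eq_some_iff] at hx ⊢
  refine ⟨?_, hx.2⟩
  have h1 := hx.1
  have h2 := hmono x.1 (show (0 : Quality) ≤ 1 by decide)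
  simp only [expectedReward, Fin.sum_univ_two, beliefOf] at h1 h2 ⊢
  simp at h1
  nlinarith [mul_pos hπ.1 h1, mul_pos hπ.2.1 (h1.trans_le h2)]

/-- Purchase decisions are left-continuous at the belief that the quality is surely high. -/
lemma tendsto_G_some_one [MeasurableSpace 𝓩] [MeasurableSingletonClass 𝓩]
    [IsProbabilityMeasure μΘ] [IsProbabilityMeasure μE]
    (hr : ∀ q, Measurable (r q)) (hf : ∀ q, Measurable fun x : Θ × E => f q x.1 x.2)
    (hmono : ∀ θ, Monotone fun q => r q θ) (z : 𝓩) (q : Quality) :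
    Tendsto (fun x => G r f μΘ μE (some z) (beliefOf x) q) (𝓝[<] 1)
      (𝓝 (G r f μΘ μE (some z) (beliefOf 1) q)) := by
  unfold G
  refine (ENNReal.tendsto_toReal (measure_ne_top _ _)).comp
    (tendsto_measure_of_tendsto_indicator_of_isFiniteMeasure _ _
      (fun x => measurableSet_observation_eq hr hf _ q _) fun y => ?_)
  simp only [Set.mem_ofPred_eq, observation_eq_some_iff]
  have h2 := hmono y.1 (show (0 : Quality) ≤ 1 by decide)
  suffices ∀ᶠ x in 𝓝[<] (1 : ℝ), (0 < expectedReward r (beliefOf x) y.1 ↔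
      0 < expectedReward r (beliefOf 1) y.1) by
    filter_upwards [this] with x hx
    rw [hx]
  simp only [expectedReward, Fin.sum_univ_two, beliefOf] at h2 ⊢
  simp only [Matrix.cons_val_zero, Matrix.cons_val_one, sub_self, zero_mul, one_mul, zero_add]
  rcases lt_or_ge 0 (r 1 y.1) with h | h
  · have hcont : Continuous fun x : ℝ => (1 - x) * r 0 y.1 + x * r 1 y.1 := by fun_prop
    have hev : ∀ᶠ x in 𝓝 (1 : ℝ), 0 < (1 - x) * r 0 y.1 + x * r 1 y.1 :=
      hcont.tendsto 1 |>.eventually_const_lt (by simpa using h)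
    filter_upwards [hev.filter_mono nhdsWithin_le_nhds] with x hx
    simp [hx, h]
  -- By monotonicity the reward is now non-positive under both qualities, so no belief leads to a
  -- purchase.
  · have h3 : ∀ᶠ x in 𝓝[<] (1 : ℝ), x ∈ Set.Ioo (0 : ℝ) 1 := Ioo_mem_nhdsLT one_pos
    filter_upwards [h3] with x hx
    refine iff_of_false (not_lt.2 ?_) (not_lt.2 h)
    nlinarith [mul_nonneg_of_nonpos_of_nonpos (sub_nonpos.2 hx.2.le) (h2.trans h), hx.1,
      mul_nonneg hx.1.le (neg_nonneg.2 h),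
      mul_nonneg (sub_nonneg.2 hx.2.le) (neg_nonneg.2 (h2.trans h))]

section Update

variable {π : Quality → ℝ} {z : Option 𝓩}

lemma Gavg_pos (hπ : IsInteriorBelief π) (h0 : 0 < G r f μΘ μE z π 0)
    (h1 : 0 < G r f μΘ μE z π 1) : 0 < Gavg r f μΘ μE z π := by
  rw [Gavg, Fin.sum_univ_two]
  exact add_pos (mul_pos hπ.1 h0) (mul_pos hπ.2.1 h1)

lemma IsInteriorBelief.stationaryUpdate (hπ : IsInteriorBelief π) (h0 : 0 < G r f μΘ μE z π 0)
    (h1 : 0 < G r f μΘ μE z π 1) : IsInteriorBelief (stationaryUpdate r f μΘ μE z π) := by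
  have hg := Gavg_pos hπ h0 h1
  refine ⟨mul_pos (div_pos h0 hg) hπ.1, mul_pos (div_pos h1 hg) hπ.2.1, ?_⟩
  simp only [SocialLearning.stationaryUpdate]
  field_simp
  rw [Gavg, Fin.sum_univ_two]
  ring

lemma logOdds_stationaryUpdate (hπ : IsInteriorBelief π) (h0 : 0 < G r f μΘ μE z π 0)
    (h1 : 0 < G r f μΘ μE z π 1) :
    logOdds (stationaryUpdate r f μΘ μE z π) =
      logOdds π + Real.log (G r f μΘ μE z π 1 / G r f μΘ μE z π 0) := by
  have hg := Gavg_pos hπ h0 h1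
  have hp0 := hπ.1
  have hp1 := hπ.2.1
  rw [logOdds, logOdds, ← Real.log_mul (by positivity) (by positivity)]
  simp only [stationaryUpdate]
  congr 1
  field_simp

end Update

/-- The drift of the log-odds under high quality, with belief `π`. -/
def drift [Fintype 𝓩] (r : Quality → Θ → ℝ) (f : Quality → Θ → E → 𝓩) (μΘ : Measure Θ)
    (μE : Measure E) (π : Quality → ℝ) : ℝ :=
  ∑ z : Option 𝓩, G r f μΘ μE z π 1 * Real.log (G r f μΘ μE z π 1 / G r f μΘ μE z π 0)

/-- Dropping `none` leaves only symbols of positive probability, where the logarithm is continuous.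
-/
lemma drift_eq_sum_some [Fintype 𝓩] (π : Quality → ℝ) : drift r f μΘ μE π =
    ∑ z : 𝓩, G r f μΘ μE (some z) π 1 *
      Real.log (G r f μΘ μE (some z) π 1 / G r f μΘ μE (some z) π 0) := by
  rw [drift, Fintype.sum_option, G_none_eq π 1 0]
  rcases eq_or_ne (G r f μΘ μE none π 0) 0 with h | h <;> simp [h]

lemma G_eq_or_pos (hident : Identifiable r f μΘ μE) {π : Quality → ℝ}
    (hπ : π ∈ stdSimplex ℝ Quality) (z : Option 𝓩) :
    G r f μΘ μE z π 1 = G r f μΘ μE z π 0 ∨ (0 < G r f μΘ μE z π 1 ∧ 0 < G r f μΘ μE z π 0) := by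
  cases z with
  | none => exact Or.inl (G_none_eq π 1 0)
  | some z => exact Or.inr ⟨(hident π hπ 1 0 (by decide)).1 z, (hident π hπ 0 1 (by decide)).1 z⟩

lemma G_pos (hident : Identifiable r f μΘ μE) {π : Quality → ℝ} (hπ : π ∈ stdSimplex ℝ Quality)
    {z : Option 𝓩} {q : Quality} (hz : 0 < G r f μΘ μE z π q) (q' : Quality) :
    0 < G r f μΘ μE z π q' := by
  rcases G_eq_or_pos hident hπ z with h | h <;> fin_cases q <;> fin_cases q' <;>
    simp_all

section Drift

variable [Fintype 𝓩] [MeasurableSpace 𝓩] [MeasurableSingletonClass 𝓩]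
    [IsProbabilityMeasure μΘ] [IsProbabilityMeasure μE]

lemma drift_nonneg (hr : ∀ q, Measurable (r q))
    (hf : ∀ q, Measurable fun x : Θ × E => f q x.1 x.2) (hident : Identifiable r f μΘ μE)
    {π : Quality → ℝ} (hπ : π ∈ stdSimplex ℝ Quality) : 0 ≤ drift r f μΘ μE π :=
  sum_mul_log_div_nonneg (G_eq_or_pos hident hπ) (by rw [sum_G hr hf, sum_G hr hf])

lemma drift_pos (hr : ∀ q, Measurable (r q))
    (hf : ∀ q, Measurable fun x : Θ × E => f q x.1 x.2) (hident : Identifiable r f μΘ μE)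
    {π : Quality → ℝ} (hπ : π ∈ stdSimplex ℝ Quality) : 0 < drift r f μΘ μE π :=
  sum_mul_log_div_pos (G_eq_or_pos hident hπ) (by rw [sum_G hr hf, sum_G hr hf])
    ((hident π hπ 1 0 (by decide)).2.imp' some fun _ h => h)

lemma tendsto_drift_one (hr : ∀ q, Measurable (r q))
    (hf : ∀ q, Measurable fun x : Θ × E => f q x.1 x.2)
    (hmono : ∀ θ, Monotone fun q => r q θ) (hident : Identifiable r f μΘ μE) :
    Tendsto (fun x => drift r f μΘ μE (beliefOf x)) (𝓝[<] 1) (𝓝 (drift r f μΘ μE (beliefOf 1))) := by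
  simp only [drift_eq_sum_some]
  have h1 := beliefOf_mem_stdSimplex zero_le_one (le_refl (1 : ℝ))
  refine tendsto_finsetSum _ fun z _ => ?_
  have hp (q : Quality) : 0 < G r f μΘ μE (some z) (beliefOf 1) q :=
    (hident _ h1 q (1 - q) (by fin_cases q <;> decide)).1 z
  have ht := tendsto_G_some_one hr hf hmono (μΘ := μΘ) (μE := μE) z
  exact (ht 1).mul (((ht 1).div (ht 0) (hp 0).ne').log (div_pos (hp 1) (hp 0)).ne')

lemma exists_isBeliefChain (hr : ∀ q, Measurable (r q))
    (hf : ∀ q, Measurable fun x : Θ × E => f q x.1 x.2)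
    (hmono : ∀ θ, Monotone fun q => r q θ) (hident : Identifiable r f μΘ μE) :
    ∃ M k κ L : ℝ, k ≤ 64 * M * κ ∧
      IsBeliefChain (G r f μΘ μE) (stationaryUpdate r f μΘ μE) (fun π q => 1 - π q)
        IsInteriorBelief logOdds M k κ L := by
  have h1 := beliefOf_mem_stdSimplex zero_le_one (le_refl (1 : ℝ))
  have hz := beliefOf_mem_stdSimplex (le_refl (0 : ℝ)) zero_le_one
  obtain ⟨z₀, -⟩ := (hident _ h1 0 1 (by decide)).2
  have : Nonempty 𝓩 := ⟨z₀⟩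
  obtain ⟨y, hy⟩ := Finite.exists_min fun y : 𝓩 × Quality =>
    G r f μΘ μE (some y.1) (beliefOf 0) y.2
  have hne : ∀ q : Quality, q ≠ 1 - q := by decide
  set g := G r f μΘ μE (some y.1) (beliefOf 0) y.2 with hg
  have hg0 : 0 < g := (hident _ hz y.2 (1 - y.2) (hne y.2)).1 y.1
  have hg1 : g ≤ 1 := G_le_one _ _ _
  -- Review probabilities lie in `[g, 1]`, so their log-ratio is at most `-log g` in absolute value;
  -- the added 1 makes `M` positive even if `g = 1`.
  set M := 1 - Real.log g with hM
  have hM0 : 1 ≤ M := by linarith [Real.log_nonpos hg0.le hg1]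
  have hd := drift_pos hr hf hident h1
  have hev := (tendsto_drift_one hr hf hmono hident).eventually_const_le (half_lt_self hd)
  obtain ⟨x₀, hx₀, hx⟩ := (mem_nhdsLT_iff_exists_Ioo_subset' (zero_lt_one (α := ℝ))).1 hev
  have hx₀' : 0 < 1 - x₀ := sub_pos.2 hx₀
  -- Odds of at least `w` force `π 1 > x₀`, where the drift is at least half its value at the belief
  -- 1. The added 1 ensures `log w ≥ 0`.
  set w := 1 + 1 / (1 - x₀) with hw
  have hw1 : 1 ≤ w := by
    have : 0 < 1 / (1 - x₀) := by positivity
    linarith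
  have hw0 : 0 < w := by linarith
  have hM0' : 0 < M := by linarith
  -- Odds below `w` leave at least `1 / (1 + w)` on low quality, hence `κ`. The second term of the
  -- minimum only secures `k ≤ 64 * M * κ`.
  refine ⟨M, min (drift r f μΘ μE (beliefOf 1) / 2) (64 * M * (1 / (1 + w))), 1 / (1 + w),
    Real.log w, min_le_right _ _, ?_⟩
  have hsum : ∀ π, IsInteriorBelief π →
      ∑ z, G r f μΘ μE z π 1 * logOdds (stationaryUpdate r f μΘ μE z π) =
        logOdds π + drift r f μΘ μE π := fun π hπ => by
    rw [drift, ← one_mul (logOdds π), ← sum_G hr hf π 1 (μΘ := μΘ) (μE := μE), Finset.sum_mul,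
      ← Finset.sum_add_distrib]
    refine Finset.sum_congr rfl fun z _ => ?_
    rcases (G_nonneg (r := r) (f := f) (μΘ := μΘ) (μE := μE) z π 1).eq_or_lt with h | h
    · simp [← h]
    · rw [logOdds_stationaryUpdate hπ (G_pos hident hπ.mem_stdSimplex h 0) h]
      ring
  refine
    { nonneg := fun z π q => G_nonneg z π q
      sum_eq_one := sum_G hr hf
      good_upd := fun z π q hπ hz => hπ.stationaryUpdate (G_pos hident hπ.mem_stdSimplex hz 0)
        (G_pos hident hπ.mem_stdSimplex hz 1)
      abs_sub_le := fun z π q hπ hz => ?_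
      le_drift := fun π hπ => ?_
      add_le_drift := fun π hπ hl => ?_
      loss_nonneg := fun π q hπ => ?_
      loss_add_loss := fun π hπ => by linarith [hπ.2.2]
      half_le_loss := fun π hπ hl => ?_
      le_loss := fun π hπ hl => ?_
      pos_M := hM0'
      pos_k := lt_min (by linarith) (by positivity)
      pos_κ := by positivity
      nonneg_L := Real.log_nonneg hw1 }
  · have hp := G_pos hident hπ.mem_stdSimplex hz
    rw [logOdds_stationaryUpdate hπ (hp 0) (hp 1), add_sub_cancel_left]
    rcases z with _ | z
    · rw [G_none_eq π 1 0, div_self (hp 0).ne', Real.log_one, abs_zero]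
      exact hM0'.le
    · have hlo (q : Quality) : Real.log g ≤ Real.log (G r f μΘ μE (some z) π q) :=
        Real.log_le_log hg0 ((hy (z, q)).trans (G_some_beliefOf_zero_le hmono hπ z q))
      have hhi (q : Quality) : Real.log (G r f μΘ μE (some z) π q) ≤ 0 :=
        Real.log_nonpos (hp q).le (G_le_one _ _ _)
      rw [Real.log_div (hp 1).ne' (hp 0).ne', abs_le]
      constructor <;> linarith [hlo 0, hlo 1, hhi 0, hhi 1]
  · rw [hsum π hπ]
    linarith [drift_nonneg hr hf hident hπ.mem_stdSimplex]
  · rw [hsum π hπ]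
    refine add_le_add_right ((min_le_left _ _).trans ?_) _
    have hp0 := hπ.1
    have hp1 := hπ.2.1
    have hlt : π 1 < 1 := by linarith [hπ.2.2]
    have hle : w * π 0 ≤ π 1 := by
      rw [logOdds, Real.log_le_log_iff hw0 (by positivity), le_div_iff₀ hp0] at hl
      exact hl
    have hgt : x₀ < π 1 := by
      have h5 : 1 / (1 - x₀) * π 0 < 1 := by nlinarith
      rw [one_div, inv_mul_lt_iff₀ hx₀'] at h5
      linarith [hπ.2.2]
    have := hx ⟨hgt, hlt⟩
    rw [hπ.eq_beliefOf]
    exact this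
  · refine sub_nonneg.2 (Fin.forall_fin_two (p := fun q => π q ≤ 1) |>.2 ⟨?_, ?_⟩ q)
    · linarith [hπ.2.1, hπ.2.2]
    · linarith [hπ.1, hπ.2.2]
  · have hp0 := hπ.1
    have hp1 := hπ.2.1
    rw [logOdds, ← Real.log_one, Real.log_le_log_iff one_pos (by positivity),
      le_div_iff₀ hp0] at hl
    linarith [hπ.2.2]
  · have hp0 := hπ.1
    have hp1 := hπ.2.1
    rw [logOdds, Real.log_lt_log_iff (by positivity) hw0, div_lt_iff₀ hp0] at hl
    rw [div_le_iff₀ (by positivity)]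
    nlinarith [hπ.2.2]

end Drift

end Feedback
end SocialLearning
end
-- From the random inputs to the value of the chain
noncomputable section
namespace SocialLearning

/-- The public history together with the current quality. -/
@[ext]
structure State (𝓩 : Type*) where
  /-- The observations made so far, latest first. -/
  history : List (Option 𝓩)
  /-- The current quality. -/
  current : Quality

/-- With finitely many reviews the states are countable, so every function of the state is
measurable. -/
instance (𝓩 : Type*) : MeasurableSpace (State 𝓩) := ⊤

instance (𝓩 : Type*) : DiscreteMeasurableSpace (State 𝓩) := ⟨fun _ => trivial⟩

instance (𝓩 : Type*) [Countable 𝓩] : Countable (State 𝓩) :=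
  Function.Injective.countable (f := fun s : State 𝓩 => (s.history, s.current))
    fun _ _ h => State.ext (congrArg Prod.fst h) (congrArg Prod.snd h)

section StateProcess

variable {Θ E 𝓩 Ω : Type*} [MeasurableSpace Θ] [MeasurableSpace E]

/-- The belief of imperfect learners after a list of observations, latest first. -/
def beliefAfter (r : Quality → Θ → ℝ) (f : Quality → Θ → E → 𝓩) (μΘ : Measure Θ)
    (μE : Measure E) : List (Option 𝓩) → Quality → ℝ
  | [] => prior
  | z :: h => stationaryUpdate r f μΘ μE z (beliefAfter r f μΘ μE h)

/-- The state after one period with inputs `u`. -/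
def step (r : Quality → Θ → ℝ) (f : Quality → Θ → E → 𝓩) (μΘ : Measure Θ) (μE : Measure E)
    (s : State 𝓩) (u : Θ × E × Quality × Bool) : State 𝓩 :=
  ⟨observation r f (beliefAfter r f μΘ μE s.1) (if u.2.2.2 then u.2.2.1 else s.2) u.1 u.2.1 :: s.1,
    if u.2.2.2 then u.2.2.1 else s.2⟩

/-- The state after consumer `t`. -/
def stateProcess (r : Quality → Θ → ℝ) (f : Quality → Θ → E → 𝓩) (μΘ : Measure Θ)
    (μE : Measure E) (U : ℕ → Ω → Θ × E × Quality × Bool) : ℕ → Ω → State 𝓩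
  -- No consumer arrives at time 0; only the initial quality is drawn.
  | 0, ω => ⟨[], (U 0 ω).2.2.1⟩
  | t + 1, ω => step r f μΘ μE (stateProcess r f μΘ μE U t ω) (U (t + 1) ω)

variable {r : Quality → Θ → ℝ} {f : Quality → Θ → E → 𝓩} {μΘ : Measure Θ} {μE : Measure E}

lemma stateProcess_snd (θ : ℕ → Ω → Θ) (ε : ℕ → Ω → E) (X : ℕ → Ω → Quality) (B : ℕ → Ω → Bool)
    (t : ℕ) (ω : Ω) :
    (stateProcess r f μΘ μE (fun t ω => (θ t ω, ε t ω, X t ω, B t ω)) t ω).2 =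
      quality X B t ω := by
  induction t with
  | zero => rfl
  | succ t ih => simp only [stateProcess, step, quality, ih]

lemma beliefAfter_stateProcess (θ : ℕ → Ω → Θ) (ε : ℕ → Ω → E) (X : ℕ → Ω → Quality)
    (B : ℕ → Ω → Bool) (t : ℕ) (ω : Ω) :
    beliefAfter r f μΘ μE
      (stateProcess r f μΘ μE (fun t ω => (θ t ω, ε t ω, X t ω, B t ω)) t ω).1 =
      posteriorImp r f μΘ μE θ ε (quality X B) (t + 1) ω := by
  induction t with
  | zero => rfl
  | succ t ih =>
    rw [posteriorImp, ← ih, ← stateProcess_snd (r := r) (f := f) (μΘ := μΘ) (μE := μE) θ ε X B]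
    rfl

lemma stationaryUpdate_mem_Icc {π : Quality → ℝ} (hπ : ∀ q, π q ∈ Set.Icc 0 1) (z : Option 𝓩)
    (q : Quality) : stationaryUpdate r f μΘ μE z π q ∈ Set.Icc 0 1 := by
  have hn (q : Quality) : 0 ≤ π q * G r f μΘ μE z π q := mul_nonneg (hπ q).1 (G_nonneg _ _ _)
  have hle : π q * G r f μΘ μE z π q ≤ Gavg r f μΘ μE z π :=
    Finset.single_le_sum (f := fun q => π q * G r f μΘ μE z π q) (fun q _ => hn q)
      (Finset.mem_univ q)
  rw [stationaryUpdate, div_mul_eq_mul_div, mul_comm]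
  exact ⟨div_nonneg (hn q) ((hn q).trans hle), div_le_one_of_le₀ hle ((hn q).trans hle)⟩

lemma beliefAfter_mem_Icc (h : List (Option 𝓩)) (q : Quality) :
    beliefAfter r f μΘ μE h q ∈ Set.Icc 0 1 := by
  induction h generalizing q with
  | nil => norm_num [beliefAfter, prior]
  | cons z h ih => exact stationaryUpdate_mem_Icc ih z q

variable [Fintype 𝓩] [MeasurableSpace 𝓩] [MeasurableSingletonClass 𝓩]

lemma measurable_comp_observation (hr : ∀ q, Measurable (r q))
    (hf : ∀ q, Measurable fun x : Θ × E => f q x.1 x.2) (π : Quality → ℝ) (q : Quality)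
    {β : Type*} [MeasurableSpace β] (g : Option 𝓩 → β) :
    Measurable fun x : Θ × E => g (observation r f π q x.1 x.2) := by
  let : MeasurableSpace (Option 𝓩) := ⊤
  exact measurable_from_top.comp
    (measurable_to_countable' fun z => measurableSet_observation_eq hr hf π q z)

lemma measurable_step (hr : ∀ q, Measurable (r q))
    (hf : ∀ q, Measurable fun x : Θ × E => f q x.1 x.2) :
    Measurable fun x : State 𝓩 × Θ × E × Quality × Bool => step r f μΘ μE x.1 x.2 := by
  refine measurable_from_prod_countable_right fun s => ?_
  have h1 : Measurable fun x : Quality × Θ × E =>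
      (⟨observation r f (beliefAfter r f μΘ μE s.1) x.1 x.2.1 x.2.2 :: s.1, x.1⟩ : State 𝓩) :=
    measurable_from_prod_countable_right fun q =>
      measurable_comp_observation hr hf _ q fun z => (⟨z :: s.1, q⟩ : State 𝓩)
  have h2 : Measurable fun b : Quality × Bool => if b.2 then b.1 else s.2 :=
    measurable_of_countable _
  exact h1.comp ((h2.comp measurable_snd.snd).prodMk
    (measurable_fst.prodMk measurable_snd.fst))

/-- A crude bound that serves integrability. -/
lemma abs_value_le [IsProbabilityMeasure μΘ] [IsProbabilityMeasure μE]
    (hr : ∀ q, Measurable (r q)) (hf : ∀ q, Measurable fun x : Θ × E => f q x.1 x.2)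
    {ρ : ℝ} (h0 : 0 ≤ ρ) (h1 : ρ ≤ 1) (n : ℕ) {π : Quality → ℝ} (hπ : ∀ q, π q ∈ Set.Icc 0 1)
    (q : Quality) :
    |value (G r f μΘ μE) (stationaryUpdate r f μΘ μE) (fun π q => 1 - π q) ρ n π q| ≤ n := by
  induction n generalizing π q with
  | zero => simp [value]
  | succ n ih =>
    rw [value, Nat.cast_succ, add_comm]
    refine (abs_add_le _ _).trans (add_le_add ?_ ?_)
    · refine (Finset.abs_sum_le_sum_abs _ _).trans ?_
      have hn : ∑ z, G r f μΘ μE z π q * (n : ℝ) = n := by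
        rw [← Finset.sum_mul, sum_G hr hf, one_mul]
      refine le_of_le_of_eq (Finset.sum_le_sum fun z _ => ?_) hn
      have hG : 0 ≤ G r f μΘ μE z π q := G_nonneg z π q
      rw [abs_mul, abs_of_nonneg hG]
      refine mul_le_mul_of_nonneg_left ?_ hG
      have hu := stationaryUpdate_mem_Icc (r := r) (f := f) (μΘ := μΘ) (μE := μE) hπ z
      have a := abs_le.1 (ih hu q)
      have b := abs_le.1 (ih hu (1 - q))
      rw [abs_le]
      constructor <;> nlinarith
    · rw [abs_le]
      constructor <;> linarith [(hπ q).1, (hπ q).2]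

/-- Expected loss over `n` further periods, before the redraw of the quality. -/
def stateValue (r : Quality → Θ → ℝ) (f : Quality → Θ → E → 𝓩) (μΘ : Measure Θ) (μE : Measure E)
    (η : ℝ) (n : ℕ) (s : State 𝓩) : ℝ :=
  (1 - η / 2) * value (G r f μΘ μE) (stationaryUpdate r f μΘ μE) (fun π q => 1 - π q) (η / 2) n
      (beliefAfter r f μΘ μE s.1) s.2 +
    η / 2 * value (G r f μΘ μE) (stationaryUpdate r f μΘ μE) (fun π q => 1 - π q) (η / 2) n
      (beliefAfter r f μΘ μE s.1) (1 - s.2)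

lemma abs_stateValue_le [IsProbabilityMeasure μΘ] [IsProbabilityMeasure μE]
    (hr : ∀ q, Measurable (r q)) (hf : ∀ q, Measurable fun x : Θ × E => f q x.1 x.2)
    {η : ℝ} (h0 : 0 ≤ η) (h1 : η ≤ 1) (n : ℕ) (s : State 𝓩) :
    |stateValue r f μΘ μE η n s| ≤ n := by
  have h (q : Quality) := abs_le.1 (abs_value_le (μΘ := μΘ) (μE := μE) hr hf
    (by linarith : 0 ≤ η / 2) (by linarith) n
    (beliefAfter_mem_Icc (r := r) (f := f) (μΘ := μΘ) (μE := μE) s.1) q)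
  have a := h s.2
  have b := h (1 - s.2)
  rw [stateValue, abs_le]
  constructor <;> nlinarith

/-- The law of a fresh draw and a redraw coin. -/
def redrawLaw (η : ℝ) : Measure (Quality × Bool) :=
  (uniformOn (Set.univ : Set Quality)).prod
    (ENNReal.ofReal η • Measure.dirac true + ENNReal.ofReal (1 - η) • Measure.dirac false)

instance : IsProbabilityMeasure (uniformOn (Set.univ : Set Quality)) :=
  isProbabilityMeasure_uniformOn Set.finite_univ Set.univ_nonempty

lemma isProbabilityMeasure_coin {η : ℝ} (h0 : 0 ≤ η) (h1 : η ≤ 1) :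
    IsProbabilityMeasure (ENNReal.ofReal η • Measure.dirac true +
      ENNReal.ofReal (1 - η) • Measure.dirac false) :=
  ⟨by simp [← ENNReal.ofReal_add h0 (sub_nonneg.2 h1)]⟩

lemma isProbabilityMeasure_redrawLaw {η : ℝ} (h0 : 0 ≤ η) (h1 : η ≤ 1) :
    IsProbabilityMeasure (redrawLaw η) := by
  have := isProbabilityMeasure_coin h0 h1
  unfold redrawLaw
  infer_instance

/-- A uniform redraw returns the old quality half of the time, so the flip probability is `η / 2`.
-/
lemma integral_redrawLaw {η : ℝ} (h0 : 0 ≤ η) (h1 : η ≤ 1) (g : Quality → ℝ) (q : Quality) :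
    ∫ b, g (if b.2 then b.1 else q) ∂redrawLaw η = (1 - η / 2) * g q + η / 2 * g (1 - q) := by
  have := isProbabilityMeasure_redrawLaw h0 h1
  have hc := isProbabilityMeasure_coin h0 h1
  have hu (x : Quality) : (uniformOn (Set.univ : Set Quality)).real {x} = 1 / 2 := by
    simp [measureReal_def, uniformOn_univ]
  have hm (x : Quality) (b : Bool) : (redrawLaw η).real {(x, b)} =
      1 / 2 * if b then η else 1 - η := by
    rw [← Set.singleton_prod_singleton, redrawLaw, measureReal_prod_prod, hu]
    congr 1
    cases b <;> simp [measureReal_def, h0, h1]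
  rw [integral_fintype .of_finite, Fintype.sum_prod_type]
  simp only [Fin.sum_univ_two, Fintype.sum_bool, hm, smul_eq_mul]
  fin_cases q <;> simp <;> ring

lemma integral_comp_observation [IsProbabilityMeasure μΘ] [IsProbabilityMeasure μE]
    (hr : ∀ q, Measurable (r q)) (hf : ∀ q, Measurable fun x : Θ × E => f q x.1 x.2)
    (π : Quality → ℝ) (q : Quality) (g : Option 𝓩 → ℝ) :
    ∫ x, g (observation r f π q x.1 x.2) ∂(μΘ.prod μE) = ∑ z, G r f μΘ μE z π q * g z := by
  let : MeasurableSpace (Option 𝓩) := ⊤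
  have : MeasurableSingletonClass (Option 𝓩) := ⟨fun _ => trivial⟩
  have hm : Measurable fun x : Θ × E => observation r f π q x.1 x.2 :=
    measurable_comp_observation hr hf π q id
  have := Measure.isProbabilityMeasure_map (μ := μΘ.prod μE) hm.aemeasurable
  rw [← integral_map (φ := fun x : Θ × E => observation r f π q x.1 x.2) hm.aemeasurable
    measurable_from_top.aestronglyMeasurable, integral_fintype .of_finite]
  refine Finset.sum_congr rfl fun z _ => ?_
  rw [map_measureReal_apply hm (measurableSet_singleton z)]
  rfl

/-- The one-period expansion of `stateValue`. -/
lemma integral_step [IsProbabilityMeasure μΘ] [IsProbabilityMeasure μE]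
    (hr : ∀ q, Measurable (r q)) (hf : ∀ q, Measurable fun x : Θ × E => f q x.1 x.2)
    {η : ℝ} (h0 : 0 ≤ η) (h1 : η ≤ 1) (n : ℕ) (s : State 𝓩) :
    ∫ u, (1 - beliefAfter r f μΘ μE s.1 (step r f μΘ μE s u).2 +
        stateValue r f μΘ μE η n (step r f μΘ μE s u)) ∂(μΘ.prod (μE.prod (redrawLaw η))) =
      stateValue r f μΘ μE η (n + 1) s := by
  have := isProbabilityMeasure_redrawLaw h0 h1
  set π := beliefAfter r f μΘ μE s.1 with hπ
  set k : State 𝓩 → ℝ := fun s' => 1 - π s'.2 + stateValue r f μΘ μE η n s' with hk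
  have hkb (s' : State 𝓩) : ‖k s'‖ ≤ 1 + n := by
    have a := beliefAfter_mem_Icc (r := r) (f := f) (μΘ := μΘ) (μE := μE) s.1 s'.2
    refine (norm_add_le _ _).trans (add_le_add ?_ (abs_stateValue_le hr hf h0 h1 n s'))
    rw [Real.norm_eq_abs, abs_le]
    constructor <;> linarith [a.1, a.2]
  set Φ : Quality → Θ × E → ℝ := fun q x =>
    k ⟨observation r f π q x.1 x.2 :: s.1, q⟩ with hΦ
  have hΦi (q : Quality) : Integrable (Φ q) (μΘ.prod μE) :=
    .of_bound (measurable_comp_observation hr hf π q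
      fun z => k (⟨z :: s.1, q⟩ : State 𝓩)).aestronglyMeasurable (1 + n) (ae_of_all _ fun _ => hkb _)
  have hint : ∀ q, ∫ x, Φ q x ∂(μΘ.prod μE) =
      value (G r f μΘ μE) (stationaryUpdate r f μΘ μE) (fun π q => 1 - π q) (η / 2) (n + 1) π q :=
    fun q => by
      rw [integral_comp_observation hr hf π q fun z => k (⟨z :: s.1, q⟩ : State 𝓩), value]
      simp only [hk, mul_add, Finset.sum_add_distrib, stateValue, beliefAfter, ← hπ]
      rw [← Finset.sum_mul, sum_G hr hf, one_mul]
  have hmeas : Measurable fun u => k (step r f μΘ μE s u) :=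
    (measurable_of_countable k).comp ((measurable_step hr hf).comp measurable_prodMk_left)
  have hi1 : Integrable (fun u => k (step r f μΘ μE s u)) (μΘ.prod (μE.prod (redrawLaw η))) :=
    .of_bound hmeas.aestronglyMeasurable (1 + n) (ae_of_all _ fun _ => hkb _)
  have hi2 (a : Θ) : Integrable (fun v => k (step r f μΘ μE s (a, v))) (μE.prod (redrawLaw η)) :=
    .of_bound (hmeas.comp measurable_prodMk_left).aestronglyMeasurable (1 + n)
      (ae_of_all _ fun _ => hkb _)
  have hred (a : Θ) (e : E) : ∫ b, k (step r f μΘ μE s (a, e, b)) ∂redrawLaw η =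
      (1 - η / 2) * Φ s.2 (a, e) + η / 2 * Φ (1 - s.2) (a, e) :=
    integral_redrawLaw h0 h1 (fun q => Φ q (a, e)) s.2
  have hi3 := ((hΦi s.2).const_mul (1 - η / 2)).add ((hΦi (1 - s.2)).const_mul (η / 2))
  calc _ = ∫ u, k (step r f μΘ μE s u) ∂(μΘ.prod (μE.prod (redrawLaw η))) := rfl
    _ = ∫ a, ∫ e, ((1 - η / 2) * Φ s.2 (a, e) + η / 2 * Φ (1 - s.2) (a, e)) ∂μE ∂μΘ := by
      rw [integral_prod _ hi1]
      congr 1 with a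
      rw [integral_prod _ (hi2 a)]
      simp only [hred]
    _ = ∫ x, ((1 - η / 2) * Φ s.2 x + η / 2 * Φ (1 - s.2) x) ∂(μΘ.prod μE) :=
      (integral_prod _ hi3).symm
    _ = _ := by
      rw [integral_add ((hΦi _).const_mul _) ((hΦi _).const_mul _), integral_const_mul,
        integral_const_mul, hint, hint]
      rfl

section Independence

variable {U : ℕ → Ω → Θ × E × Quality × Bool}

lemma measurable_stateProcess_iSup (hr : ∀ q, Measurable (r q))
    (hf : ∀ q, Measurable fun x : Θ × E => f q x.1 x.2) (t : ℕ) :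
    Measurable[⨆ i ∈ Set.Iic t, MeasurableSpace.comap (U i) inferInstance]
      (stateProcess r f μΘ μE U t) := by
  have hU {i t : ℕ} (h : i ≤ t) :
      Measurable[⨆ i ∈ Set.Iic t, MeasurableSpace.comap (U i) inferInstance] (U i) :=
    (comap_measurable (U i)).mono
      (le_iSup₂ (f := fun i (_ : i ∈ Set.Iic t) => MeasurableSpace.comap (U i) inferInstance) i h)
      le_rfl
  induction t with
  | zero =>
    have h : Measurable fun u : Θ × E × Quality × Bool => (⟨[], u.2.2.1⟩ : State 𝓩) :=
      (measurable_of_countable fun q : Quality => (⟨[], q⟩ : State 𝓩)).comp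
        measurable_snd.snd.fst
    exact h.comp (hU le_rfl)
  | succ t ih =>
    have h := ih.mono (biSup_mono fun i (hi : i ∈ Set.Iic t) =>
      Set.Iic_subset_Iic.2 t.le_succ hi) le_rfl
    exact (measurable_step hr hf).comp (h.prodMk (hU le_rfl))

variable [MeasurableSpace Ω] {P : Measure Ω}

/-- The state after consumer `t` is a function of the inputs up to time `t`. -/
lemma indepFun_stateProcess (hr : ∀ q, Measurable (r q))
    (hf : ∀ q, Measurable fun x : Θ × E => f q x.1 x.2) (hU : ∀ t, Measurable (U t))
    (hind : iIndepFun U P) (t : ℕ) :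
    IndepFun (stateProcess r f μΘ μE U t) (U (t + 1)) P := by
  have h := indep_iSup_of_disjoint (fun i => (hU i).comap_le) hind.iIndep
    (S := Set.Iic t) (T := {t + 1}) (by simp)
  rw [iSup_singleton] at h
  rw [IndepFun_iff_Indep]
  exact indep_of_indep_of_le_left h (measurable_stateProcess_iSup hr hf t).comap_le

lemma measurable_stateProcess (hr : ∀ q, Measurable (r q))
    (hf : ∀ q, Measurable fun x : Θ × E => f q x.1 x.2) (hU : ∀ t, Measurable (U t)) (t : ℕ) :
    Measurable (stateProcess r f μΘ μE U t) :=
  (measurable_stateProcess_iSup hr hf t).mono (iSup₂_le fun i _ => (hU i).comap_le) le_rfl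

variable [IsProbabilityMeasure μΘ] [IsProbabilityMeasure μE] [IsProbabilityMeasure P]

/-- By independence the joint law of state and next input is a product, and the inner integral is
`integral_step`. -/
lemma integral_stateProcess_succ (hr : ∀ q, Measurable (r q))
    (hf : ∀ q, Measurable fun x : Θ × E => f q x.1 x.2) (hU : ∀ t, Measurable (U t))
    {η : ℝ} (h0 : 0 ≤ η) (h1 : η ≤ 1)
    (hlaw : ∀ t, P.map (U t) = μΘ.prod (μE.prod (redrawLaw η))) (hind : iIndepFun U P)
    (n t : ℕ) :
    ∫ ω, (1 - beliefAfter r f μΘ μE (stateProcess r f μΘ μE U t ω).1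
          (stateProcess r f μΘ μE U (t + 1) ω).2 +
        stateValue r f μΘ μE η n (stateProcess r f μΘ μE U (t + 1) ω)) ∂P =
      ∫ ω, stateValue r f μΘ μE η (n + 1) (stateProcess r f μΘ μE U t ω) ∂P := by
  have := isProbabilityMeasure_redrawLaw h0 h1
  have hS := measurable_stateProcess (μΘ := μΘ) (μE := μE) hr hf hU t
  have hm := (indepFun_iff_map_prod_eq_prod_map_map hS.aemeasurable (hU (t + 1)).aemeasurable).1
    (indepFun_stateProcess hr hf hU hind t)
  have := Measure.isProbabilityMeasure_map (μ := P) hS.aemeasurable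
  set k : State 𝓩 × Θ × E × Quality × Bool → ℝ := fun x =>
    1 - beliefAfter r f μΘ μE x.1.1 (step r f μΘ μE x.1 x.2).2 +
      stateValue r f μΘ μE η n (step r f μΘ μE x.1 x.2) with hk
  have hkm : Measurable k := measurable_from_prod_countable_right fun s =>
    (measurable_of_countable fun s' : State 𝓩 => 1 - beliefAfter r f μΘ μE s.1 s'.2 +
      stateValue r f μΘ μE η n s').comp ((measurable_step hr hf).comp measurable_prodMk_left)
  have hkb (x) : ‖k x‖ ≤ 1 + n := by
    have a := beliefAfter_mem_Icc (r := r) (f := f) (μΘ := μΘ) (μE := μE) x.1.1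
      (step r f μΘ μE x.1 x.2).2
    refine (norm_add_le _ _).trans (add_le_add ?_ (abs_stateValue_le hr hf h0 h1 n _))
    rw [Real.norm_eq_abs, abs_le]
    constructor <;> linarith [a.1, a.2]
  calc _ = ∫ ω, k (stateProcess r f μΘ μE U t ω, U (t + 1) ω) ∂P := rfl
    _ = ∫ x, k x ∂(P.map fun ω => (stateProcess r f μΘ μE U t ω, U (t + 1) ω)) :=
      (integral_map (hS.prodMk (hU (t + 1))).aemeasurable hkm.aestronglyMeasurable).symm
    _ = ∫ s, ∫ u, k (s, u) ∂(μΘ.prod (μE.prod (redrawLaw η)))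
          ∂(P.map (stateProcess r f μΘ μE U t)) := by
      rw [hm, hlaw]
      exact integral_prod _ (.of_bound hkm.aestronglyMeasurable (1 + n) (ae_of_all _ hkb))
    _ = ∫ s, stateValue r f μΘ μE η (n + 1) s ∂(P.map (stateProcess r f μΘ μE U t)) := by
      congr 1 with s
      exact integral_step hr hf h0 h1 n s
    _ = _ := integral_map hS.aemeasurable (measurable_of_countable _).aestronglyMeasurable

lemma integrable_stateValue (hr : ∀ q, Measurable (r q))
    (hf : ∀ q, Measurable fun x : Θ × E => f q x.1 x.2) (hU : ∀ t, Measurable (U t))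
    {η : ℝ} (h0 : 0 ≤ η) (h1 : η ≤ 1) (n t : ℕ) :
    Integrable (fun ω => stateValue r f μΘ μE η n (stateProcess r f μΘ μE U t ω)) P :=
  .of_bound ((measurable_of_countable (stateValue r f μΘ μE η n)).comp
    (measurable_stateProcess hr hf hU t)).aestronglyMeasurable n
    (ae_of_all _ fun _ => abs_stateValue_le hr hf h0 h1 n _)

lemma sum_integral_eq_integral_stateValue (hr : ∀ q, Measurable (r q))
    (hf : ∀ q, Measurable fun x : Θ × E => f q x.1 x.2) (hU : ∀ t, Measurable (U t))
    {η : ℝ} (h0 : 0 ≤ η) (h1 : η ≤ 1)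
    (hlaw : ∀ t, P.map (U t) = μΘ.prod (μE.prod (redrawLaw η))) (hind : iIndepFun U P)
    (n t : ℕ) :
    ∑ i ∈ Finset.range n, ∫ ω, (1 - beliefAfter r f μΘ μE (stateProcess r f μΘ μE U (t + i) ω).1
        (stateProcess r f μΘ μE U (t + i + 1) ω).2) ∂P =
      ∫ ω, stateValue r f μΘ μE η n (stateProcess r f μΘ μE U t ω) ∂P := by
  induction n generalizing t with
  | zero => simp [stateValue, value]
  | succ n ih =>
    have hi : Integrable (fun ω => 1 - beliefAfter r f μΘ μE (stateProcess r f μΘ μE U t ω).1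
        (stateProcess r f μΘ μE U (t + 1) ω).2) P := by
      have hS (t : ℕ) := measurable_stateProcess (μΘ := μΘ) (μE := μE) hr hf hU t
      have hm : Measurable fun x : State 𝓩 × State 𝓩 => 1 - beliefAfter r f μΘ μE x.1.1 x.2.2 :=
        measurable_of_countable _
      refine .of_bound (hm.comp ((hS t).prodMk (hS (t + 1)))).aestronglyMeasurable 1
        (ae_of_all _ fun ω => ?_)
      have a := beliefAfter_mem_Icc (r := r) (f := f) (μΘ := μΘ) (μE := μE)
        (stateProcess r f μΘ μE U t ω).1 (stateProcess r f μΘ μE U (t + 1) ω).2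
      rw [Real.norm_eq_abs, abs_le]
      constructor <;> linarith [a.1, a.2]
    rw [Finset.sum_range_succ', ← integral_stateProcess_succ hr hf hU h0 h1 hlaw hind n t,
      integral_add hi (integrable_stateValue hr hf hU h0 h1 n (t + 1)), ← ih (t + 1), add_comm]
    simp only [add_zero, add_assoc, add_comm 1]

end Independence

/-- The history up to consumer `t` determines the belief at `t + 1`, so the losses at times `1, …,
T` are those of the `T` steps that start from the empty history. -/
lemma IsDynamicModel.lossImp_eq [MeasurableSpace Ω] {P : Measure Ω}
    [IsProbabilityMeasure μΘ] [IsProbabilityMeasure μE] [IsProbabilityMeasure P]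
    (hr : ∀ q, Measurable (r q)) (hf : ∀ q, Measurable fun x : Θ × E => f q x.1 x.2)
    {η : ℝ} (h0 : 0 ≤ η) (h1 : η ≤ 1) {θ : ℕ → Ω → Θ} {ε : ℕ → Ω → E} {X : ℕ → Ω → Quality}
    {B : ℕ → Ω → Bool} (hmod : IsDynamicModel P μΘ μE η θ ε X B) (T : ℕ) :
    lossImp r f μΘ μE P θ ε X B T =
      ∫ ω, stateValue r f μΘ μE η T (⟨[], X 0 ω⟩ : State 𝓩) ∂P := by
  have hU : ∀ t, Measurable fun ω => (θ t ω, ε t ω, X t ω, B t ω) := fun t =>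
    (hmod.measurable_preference t).prodMk ((hmod.measurable_noise t).prodMk
      ((hmod.measurable_draw t).prodMk (hmod.measurable_coin t)))
  have h := sum_integral_eq_integral_stateValue (μΘ := μΘ) (μE := μE) hr hf hU h0 h1 hmod.law
    hmod.indep T 0
  simp only [beliefAfter_stateProcess, stateProcess_snd] at h
  refine Eq.trans ?_ h
  rw [lossImp, ← Finset.Ico_add_one_right_eq_Icc, Finset.sum_Ico_eq_sum_range]
  simp only [add_tsub_cancel_right, zero_add, add_comm 1]

end StateProcess

lemma isInteriorBelief_prior : IsInteriorBelief prior := by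
  norm_num [IsInteriorBelief, prior]

end SocialLearning
end

theorem mainTheorem5 {Θ E 𝓩 : Type*} [MeasurableSpace Θ] [MeasurableSpace E]
    [Fintype 𝓩] [MeasurableSpace 𝓩] [MeasurableSingletonClass 𝓩]
    (r : SocialLearning.Quality → Θ → ℝ) (hr : ∀ q, Measurable (r q))
    (f : SocialLearning.Quality → Θ → E → 𝓩)
    (hf : ∀ q, Measurable (fun x : Θ × E => f q x.1 x.2))
    (μΘ : Measure Θ) [IsProbabilityMeasure μΘ] (μE : Measure E) [IsProbabilityMeasure μE]
    (hpurchase : SocialLearning.PurchaseGuarantee r μΘ)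
    (hident : SocialLearning.Identifiable r f μΘ μE) :
    ∀ c₀ : ℝ, 0 < c₀ → ∃ c : ℝ, 0 < c ∧
      ∀ (T : ℕ) (η : ℝ), 1 ≤ T → 0 < η → η < 1 / 2 → c₀ ≤ η * T →
        ∀ {Ω : Type*} [MeasurableSpace Ω] (P : Measure Ω) [IsProbabilityMeasure P]
          (θ : ℕ → Ω → Θ) (ε : ℕ → Ω → E)
          (X : ℕ → Ω → SocialLearning.Quality) (B : ℕ → Ω → Bool),
          SocialLearning.IsDynamicModel P μΘ μE η θ ε X B →
            c * T ≤ SocialLearning.lossImp r f μΘ μE P θ ε X B T := by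
  intro c₀ hc₀
  obtain ⟨M, k, κ, L, hk, hc⟩ := SocialLearning.exists_isBeliefChain hr hf hpurchase.1 hident
  obtain ⟨c, hc0, hbound⟩ := hc.exists_mul_le_redraw_value hk hc₀
  refine ⟨c, hc0, fun T η hT hη0 hη1 hηT Ω _ P _ θ ε X B hmod => ?_⟩
  have h0 := hη0.le
  have h1 : η ≤ 1 := by linarith
  rw [hmod.lossImp_eq hr hf h0 h1]
  have hint : Integrable (fun ω => SocialLearning.stateValue r f μΘ μE η T
      ⟨[], X 0 ω⟩) P :=
    .of_bound ((measurable_of_countable fun q => SocialLearning.stateValue r f μΘ μE η T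
      ⟨[], q⟩).comp (hmod.measurable_draw 0)).aestronglyMeasurable T
      (ae_of_all _ fun _ => SocialLearning.abs_stateValue_le hr hf h0 h1 T _)
  calc c * T = ∫ _, c * T ∂P := by simp
    -- The bound holds for either initial quality, hence pointwise in `ω`.
    _ ≤ _ := integral_mono (integrable_const _) hint fun ω =>
      hbound T η hT hη0 hη1 hηT _ SocialLearning.isInteriorBelief_prior (X 0 ω)
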